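/- Throughout, $\otimes$ denotes the minimal (spatial) tensor product of C*-algebras. For a unital C*-algebra $B$ let $\mathcal U(B)$ be its unitary group with the norm topology and $\mathcal U_0(B)$ the connected component of $\mathbf 1_B$ in $\mathcal U(B)$. A unital separable C*-algebra $\mathcal D$ is *strongly self-absorbing* if $\mathcal D\not\cong\mathbb C$ and there are a $^*$-isomorphism $\varphi:\mathcal D\to\mathcal D\otimes\mathcal D$ and a sequence of unitaries $(u_n)_{n\in\mathbb N}$ in $\mathcal D\otimes\mathcal D$ such that $\|u_n\varphi(d)u_n^*-d\otimes\mathbf 1_{\mathcal D}\|\to 0$ as $n\to\infty$ for every $d\in\mathcal D$. It is *$K_1$-injective* if the canonical map $\mathcal U(\mathcal D)/\mathcal U_0(\mathcal D)\to K_1(\mathcal D)=\varinjlim_n \mathcal U(M_n(\mathcal D))/\mathcal U_0(M_n(\mathcal D))$ is injective, the connecting maps of the limit being induced by $u\mapsto\mathrm{diag}(u,\mathbf 1)$. For unital C*-algebras $\mathcal D$ and $B$, two unital $^*$-homomorphisms $\sigma,\gamma:\mathcal D\to B$ are *homotopic* if there are unital $^*$-homomorphisms $h_t:\mathcal D\to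 B$, $t\in[0,1]$, with $h_0=\sigma$, $h_1=\gamma$ and $t\mapsto h_t(d)$ norm continuous for every $d\in\mathcal D$. Let $[\mathcal D,B]$ denote the set of homotopy classes of unital $^*$-homomorphisms from $\mathcal D$ to $B$. **Corollary.** Let $\mathcal D$ and $A$ be unital C*-algebras. If $\mathcal D$ is separable, strongly self-absorbing and $K_1$-injective, then $[\mathcal D,A\otimes\mathcal D]$ is a singleton, i.e. it has exactly one element. -/

import Mathlib

universe u v

noncomputable section

namespace CStarTensor

open scoped ComplexOrder TensorProduct ENNReal

section HilbertTensor

variable (H : Type u) (K : Type v) [NormedAddCommGroup H] [InnerProductSpace ℂ H]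
  [NormedAddCommGroup K] [InnerProductSpace ℂ K]

/-- The Hilbert space tensor product of `H` and `K`: the completion of the algebraic tensor
product for the inner product `⟪x ⊗ y, x' ⊗ y'⟫ = ⟪x, x'⟫ * ⟪y, y'⟫`. -/
abbrev HilbertTensor : Type (max u v) := UniformSpace.Completion (H ⊗[ℂ] K)

variable {H K}

/-- The bounded operator `S ⊗ T` on the Hilbert space tensor product. -/
def opTensor (S : H →L[ℂ] H) (T : K →L[ℂ] K) :
    HilbertTensor H K →L[ℂ] HilbertTensor H K :=
  (TensorProduct.mapL S T).completion

theorem opTensor_coe (S : H →L[ℂ] H) (T : K →L[ℂ] K) (x : H ⊗[ℂ] K) :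
    opTensor S T (x : HilbertTensor H K) = (TensorProduct.mapL S T x : H ⊗[ℂ] K) :=
  ContinuousLinearMap.completion_apply_coe _ _

theorem ext_coe {f g : HilbertTensor H K →L[ℂ] HilbertTensor H K}
    (h : ∀ x : H ⊗[ℂ] K, f (x : HilbertTensor H K) = g (x : HilbertTensor H K)) : f = g := by
  ext x
  induction x using UniformSpace.Completion.induction_on with
  | hp => exact isClosed_eq f.continuous g.continuous
  | ih x => exact h x

theorem opTensor_one : opTensor (1 : H →L[ℂ] H) (1 : K →L[ℂ] K) = 1 :=
  ext_coe fun x ↦ by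
    rw [opTensor_coe]
    have : TensorProduct.mapL (1 : H →L[ℂ] H) (1 : K →L[ℂ] K) = .id ℂ _ :=
      TensorProduct.mapL_id_id
    rw [this]; rfl

theorem opTensor_mul (S S' : H →L[ℂ] H) (T T' : K →L[ℂ] K) :
    opTensor (S * S') (T * T') = opTensor S T * opTensor S' T' :=
  ext_coe fun x ↦ by
    rw [opTensor_coe, TensorProduct.mapL_mul]
    simp only [mul_apply_eq_comp, opTensor_coe]

theorem opTensor_add_left (S S' : H →L[ℂ] H) (T : K →L[ℂ] K) :
    opTensor (S + S') T = opTensor S T + opTensor S' T :=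
  ext_coe fun x ↦ by
    rw [opTensor_coe, TensorProduct.mapL_add_left]
    simp only [add_apply, opTensor_coe, UniformSpace.Completion.coe_add]

theorem opTensor_add_right (S : H →L[ℂ] H) (T T' : K →L[ℂ] K) :
    opTensor S (T + T') = opTensor S T + opTensor S T' :=
  ext_coe fun x ↦ by
    rw [opTensor_coe, TensorProduct.mapL_add_right]
    simp only [add_apply, opTensor_coe, UniformSpace.Completion.coe_add]

theorem opTensor_smul_left (c : ℂ) (S : H →L[ℂ] H) (T : K →L[ℂ] K) :
    opTensor (c • S) T = c • opTensor S T :=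
  ext_coe fun x ↦ by
    rw [opTensor_coe, TensorProduct.mapL_smul_left]
    simp only [smul_apply, opTensor_coe, UniformSpace.Completion.coe_smul]

theorem opTensor_smul_right (c : ℂ) (S : H →L[ℂ] H) (T : K →L[ℂ] K) :
    opTensor S (c • T) = c • opTensor S T :=
  ext_coe fun x ↦ by
    rw [opTensor_coe, TensorProduct.mapL_smul_right]
    simp only [smul_apply, opTensor_coe, UniformSpace.Completion.coe_smul]

variable [CompleteSpace H] [CompleteSpace K]

theorem opTensor_star (S : H →L[ℂ] H) (T : K →L[ℂ] K) :
    opTensor (star S) (star T) = star (opTensor S T) := by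
  refine (ContinuousLinearMap.eq_adjoint_iff _ _).mpr fun x y ↦ ?_
  induction x, y using UniformSpace.Completion.induction_on₂ with
  | hp => apply isClosed_eq <;> fun_prop
  | ih x y =>
    rw [opTensor_coe, opTensor_coe, UniformSpace.Completion.inner_coe,
      UniformSpace.Completion.inner_coe]
    induction x with
    | zero => simp
    | add x x' hx hx' => simp only [map_add, inner_add_left, hx, hx']
    | tmul a b =>
      induction y with
      | zero => simp
      | add y y' hy hy' => simp only [map_add, inner_add_right, hy, hy']
      | tmul c d =>
        rw [TensorProduct.mapL_tmul, TensorProduct.mapL_tmul, TensorProduct.inner_tmul,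
          TensorProduct.inner_tmul, ContinuousLinearMap.star_eq_adjoint,
          ContinuousLinearMap.star_eq_adjoint, ContinuousLinearMap.adjoint_inner_left,
          ContinuousLinearMap.adjoint_inner_left]

variable (H K)

/-- The *-homomorphism `S ↦ S ⊗ 1`. -/
def ampLeft : (H →L[ℂ] H) →⋆ₐ[ℂ] (HilbertTensor H K →L[ℂ] HilbertTensor H K) where
  toFun S := opTensor S 1
  map_one' := opTensor_one
  map_mul' S S' := by rw [← opTensor_mul, one_mul]
  map_zero' := by simpa using opTensor_smul_left (0 : ℂ) (0 : H →L[ℂ] H) (1 : K →L[ℂ] K)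
  map_add' S S' := opTensor_add_left S S' 1
  commutes' c := by
    rw [Algebra.algebraMap_eq_smul_one, opTensor_smul_left, opTensor_one,
      Algebra.algebraMap_eq_smul_one]
  map_star' S := by rw [← opTensor_star, star_one]

/-- The *-homomorphism `T ↦ 1 ⊗ T`. -/
def ampRight : (K →L[ℂ] K) →⋆ₐ[ℂ] (HilbertTensor H K →L[ℂ] HilbertTensor H K) where
  toFun T := opTensor 1 T
  map_one' := opTensor_one
  map_mul' S S' := by rw [← opTensor_mul, one_mul]
  map_zero' := by simpa using opTensor_smul_right (0 : ℂ) (1 : H →L[ℂ] H) (0 : K →L[ℂ] K)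
  map_add' S S' := opTensor_add_right 1 S S'
  commutes' c := by
    rw [Algebra.algebraMap_eq_smul_one, opTensor_smul_right, opTensor_one,
      Algebra.algebraMap_eq_smul_one]
  map_star' S := by rw [← opTensor_star, star_one]

end HilbertTensor

section States

/-- The states of a unital C*-algebra: the positive linear functionals with value `1` at `1`. -/
def State (A : Type u) [CStarAlgebra A] : Type u :=
  letI := CStarAlgebra.spectralOrder A
  {φ : A →ₚ[ℂ] ℂ // φ 1 = 1}

variable {A : Type u} [CStarAlgebra A]

/-- The GNS Hilbert space of a state. -/
def State.Space (φ : State A) : Type u :=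
  letI := CStarAlgebra.spectralOrder A
  letI := CStarAlgebra.spectralOrderedRing A
  PositiveLinearMap.GNS φ.1

instance (φ : State A) : NormedAddCommGroup φ.Space :=
  letI := CStarAlgebra.spectralOrder A
  letI := CStarAlgebra.spectralOrderedRing A
  inferInstanceAs (NormedAddCommGroup (PositiveLinearMap.GNS φ.1))

instance (φ : State A) : InnerProductSpace ℂ φ.Space :=
  letI := CStarAlgebra.spectralOrder A
  letI := CStarAlgebra.spectralOrderedRing A
  inferInstanceAs (InnerProductSpace ℂ (PositiveLinearMap.GNS φ.1))

instance (φ : State A) : CompleteSpace φ.Space :=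
  letI := CStarAlgebra.spectralOrder A
  letI := CStarAlgebra.spectralOrderedRing A
  inferInstanceAs (CompleteSpace (PositiveLinearMap.GNS φ.1))

/-- The GNS representation of a state. -/
def State.rep (φ : State A) : A →⋆ₐ[ℂ] (φ.Space →L[ℂ] φ.Space) :=
  letI := CStarAlgebra.spectralOrder A
  letI := CStarAlgebra.spectralOrderedRing A
  PositiveLinearMap.gnsStarAlgHom φ.1

instance (φ : State A) : Nontrivial φ.Space := by
  let _ := CStarAlgebra.spectralOrder A
  let _ := CStarAlgebra.spectralOrderedRing A
  let ξ : PositiveLinearMap.PreGNS φ.1 := PositiveLinearMap.toPreGNS φ.1 1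
  have h : ‖ξ‖ = 1 := by
    rw [PositiveLinearMap.preGNS_norm_def]
    have : φ.1 1 = 1 := φ.2
    simp [ξ, this]
  refine ⟨⟨((ξ : PositiveLinearMap.GNS φ.1)), (0 : PositiveLinearMap.GNS φ.1), fun h0 ↦ ?_⟩⟩
  have h1 : ‖(ξ : PositiveLinearMap.GNS φ.1)‖ = 1 := by
    rw [UniformSpace.Completion.norm_coe, h]
  rw [h0, norm_zero] at h1
  exact zero_ne_one h1

instance {H : Type u} {K : Type v} [NormedAddCommGroup H] [InnerProductSpace ℂ H]
    [NormedAddCommGroup K] [InnerProductSpace ℂ K] [Nontrivial H] [Nontrivial K] :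
    Nontrivial (HilbertTensor H K) := by
  obtain ⟨x, hx⟩ := exists_ne (0 : H)
  obtain ⟨y, hy⟩ := exists_ne (0 : K)
  refine ⟨⟨((x ⊗ₜ[ℂ] y : H ⊗[ℂ] K) : HilbertTensor H K), 0, fun h ↦ ?_⟩⟩
  have := congrArg norm h
  rw [UniformSpace.Completion.norm_coe, TensorProduct.norm_tmul, norm_zero] at this
  simp_all

end States


section MinTensor

/-- The bounded families in a product of nonzero unital C*-algebras, with the supremum norm. -/
instance lpInftyCStarAlgebra {I : Type u} (E : I → Type v) [∀ i, Nontrivial (E i)]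
    [∀ i, CStarAlgebra (E i)] : CStarAlgebra (lp E ∞) where

/-- A family of unital *-homomorphisms into C*-algebras, as one into the bounded families. -/
def lpPi {I : Type u} {E : I → Type v} [∀ i, Nontrivial (E i)] [∀ i, CStarAlgebra (E i)]
    {A : Type*} [CStarAlgebra A] (f : ∀ i, A →⋆ₐ[ℂ] E i) : A →⋆ₐ[ℂ] lp E ∞ where
  toFun a := ⟨fun i ↦ f i a, memℓp_infty ⟨‖a‖, by
    rintro _ ⟨i, rfl⟩
    exact NonUnitalStarAlgHom.norm_apply_le (f i) a⟩⟩
  map_one' := by ext i; exact map_one (f i)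
  map_mul' a b := by ext i; exact map_mul (f i) a b
  map_zero' := by ext i; exact map_zero (f i)
  map_add' a b := by ext i; exact map_add (f i) a b
  commutes' c := by ext i; exact AlgHomClass.commutes (f i) c
  map_star' a := by ext i; exact map_star (f i) a

/-- The closed unital *-subalgebra of a unital C*-algebra generated by a set. -/
def closedAdjoin {R : Type u} [CStarAlgebra R] (S : Set R) : StarSubalgebra ℂ R :=
  (StarAlgebra.adjoin ℂ S).topologicalClosure

theorem subset_closedAdjoin {R : Type u} [CStarAlgebra R] (S : Set R) :
    S ⊆ (closedAdjoin S : Set R) := fun _ hx ↦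
  StarSubalgebra.le_topologicalClosure _ (StarAlgebra.subset_adjoin ℂ S hx)

instance {R : Type u} [CStarAlgebra R] (S : Set R) : IsClosed (closedAdjoin S : Set R) :=
  StarSubalgebra.isClosed_topologicalClosure _

instance {R : Type u} [CStarAlgebra R] (S : Set R) : CStarAlgebra (closedAdjoin S) :=
  StarSubalgebra.cstarAlgebra (closedAdjoin S)

variable (A : Type u) (B : Type v) [CStarAlgebra A] [CStarAlgebra B]

/-- The C*-algebra of block diagonal bounded operators on the Hilbert space direct sum, over all
pairs `(φ, ψ)` of a state of `A` and a state of `B`, of the Hilbert spaces `H_φ ⊗ H_ψ`. This direct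
sum is the tensor product of the Hilbert spaces of the universal representations of `A` and
`B`. -/
def BlockOp : Type (max u v) :=
  lp (fun p : State A × State B ↦
    (HilbertTensor p.1.Space p.2.Space →L[ℂ] HilbertTensor p.1.Space p.2.Space)) ∞

instance : CStarAlgebra (BlockOp A B) :=
  lpInftyCStarAlgebra (fun p : State A × State B ↦
    (HilbertTensor p.1.Space p.2.Space →L[ℂ] HilbertTensor p.1.Space p.2.Space))

/-- The *-homomorphism `a ↦ π(a) ⊗ 1`, where `π` is the universal representation of `A`. -/
def leftRep : A →⋆ₐ[ℂ] BlockOp A B :=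
  lpPi (E := fun p : State A × State B ↦
    (HilbertTensor p.1.Space p.2.Space →L[ℂ] HilbertTensor p.1.Space p.2.Space))
    fun p ↦ (ampLeft p.1.Space p.2.Space).comp p.1.rep

/-- The *-homomorphism `b ↦ 1 ⊗ ρ(b)`, where `ρ` is the universal representation of `B`. -/
def rightRep : B →⋆ₐ[ℂ] BlockOp A B :=
  lpPi (E := fun p : State A × State B ↦
    (HilbertTensor p.1.Space p.2.Space →L[ℂ] HilbertTensor p.1.Space p.2.Space))
    fun p ↦ (ampRight p.1.Space p.2.Space).comp p.2.rep

set_option linter.checkUnivs false in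
/-- The minimal (spatial) C*-tensor product `A ⊗ B`: the norm closure of the image of the algebraic
tensor product under the tensor product of the universal representations of `A` and `B`, that is,
the closed *-subalgebra generated by the operators `π(a) ⊗ ρ(b) = (π(a) ⊗ 1) (1 ⊗ ρ(b))`. -/
def MinTensor : Type (max u v) :=
  closedAdjoin (Set.range fun p : A × B ↦ leftRep A B p.1 * rightRep A B p.2)

instance : CStarAlgebra (MinTensor A B) :=
  inferInstanceAs (CStarAlgebra
    (closedAdjoin (Set.range fun p : A × B ↦ leftRep A B p.1 * rightRep A B p.2)))

variable {A B} in
/-- The elementary tensor `a ⊗ b`. -/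
def MinTensor.tmul (a : A) (b : B) : MinTensor A B :=
  ⟨leftRep A B a * rightRep A B b,
    subset_closedAdjoin _ ⟨(a, b), rfl⟩⟩

/-- The unital *-homomorphism `A → A ⊗ B`, `a ↦ a ⊗ 1`. -/
def MinTensor.inclLeft : A →⋆ₐ[ℂ] MinTensor A B where
  toFun a := MinTensor.tmul a 1
  map_one' := Subtype.ext <| by
    change leftRep A B 1 * rightRep A B 1 = 1
    rw [map_one, map_one, one_mul]
  map_mul' a b := Subtype.ext <| by
    change leftRep A B (a * b) * rightRep A B 1 =
      leftRep A B a * rightRep A B 1 * (leftRep A B b * rightRep A B 1)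
    rw [map_one, map_mul, mul_one, mul_one, mul_one]
  map_zero' := Subtype.ext <| by
    change leftRep A B 0 * rightRep A B 1 = 0
    rw [map_zero, zero_mul]
  map_add' a b := Subtype.ext <| by
    change leftRep A B (a + b) * rightRep A B 1 =
      leftRep A B a * rightRep A B 1 + leftRep A B b * rightRep A B 1
    rw [map_add, add_mul]
  commutes' c := Subtype.ext <| by
    change leftRep A B (algebraMap ℂ A c) * rightRep A B 1 = algebraMap ℂ (BlockOp A B) c
    rw [map_one, mul_one]
    exact AlgHomClass.commutes (leftRep A B) c
  map_star' a := Subtype.ext <| by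
    change leftRep A B (star a) * rightRep A B 1 = star (leftRep A B a * rightRep A B 1)
    rw [map_one, mul_one, mul_one, map_star]

end MinTensor

section StronglySelfAbsorbing

variable {A : Type u} {B : Type v} [CStarAlgebra A] [CStarAlgebra B]

/-- Approximate unitary equivalence of unital *-homomorphisms. -/
def ApproxUnitarilyEquiv (σ γ : A →⋆ₐ[ℂ] B) : Prop :=
  ∃ u : ℕ → unitary B, ∀ a : A,
    Filter.Tendsto (fun n ↦ ‖(u n : B) * σ a * star (u n : B) - γ a‖) Filter.atTop (nhds 0)

/-- A unital C*-algebra `D` is strongly self-absorbing if it is not (isomorphic to) `ℂ` and there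
is a *-isomorphism `D → D ⊗ D` that is approximately unitarily equivalent to `d ↦ d ⊗ 1`.
Separability is a separate hypothesis. -/
structure IsStronglySelfAbsorbing (D : Type u) [CStarAlgebra D] : Prop where
  ne_complex : IsEmpty (D ≃⋆ₐ[ℂ] ℂ)
  exists_iso : ∃ φ : D ≃⋆ₐ[ℂ] MinTensor D D,
    ApproxUnitarilyEquiv (φ : D →⋆ₐ[ℂ] MinTensor D D) (MinTensor.inclLeft D D)

end StronglySelfAbsorbing

section KOne

theorem conn_normal (G : Type u) [Group G] [TopologicalSpace G] [IsTopologicalGroup G] :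
    (Subgroup.connectedComponentOfOne G).Normal where
  conj_mem g hg h := by
    have hc : Continuous fun x : G ↦ h * x * h⁻¹ := by fun_prop
    have hm := hc.image_connectedComponent_subset (1 : G) ⟨g, hg, rfl⟩
    simp only [mul_one, mul_inv_cancel] at hm
    exact hm

instance (G : Type u) [Group G] [TopologicalSpace G] [IsTopologicalGroup G] :
    (Subgroup.connectedComponentOfOne G).Normal := conn_normal G

/-- The quotient `G / G_0` of a topological group by the connected component of its unit. -/
abbrev PiZero (G : Type u) [Group G] [TopologicalSpace G] [IsTopologicalGroup G] : Type u :=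
  G ⧸ Subgroup.connectedComponentOfOne G

/-- The homomorphism `G / G_0 → H / H_0` induced by a continuous homomorphism `G → H`. -/
def PiZero.map {G H : Type u} [Group G] [TopologicalSpace G] [IsTopologicalGroup G]
    [Group H] [TopologicalSpace H] [IsTopologicalGroup H] (f : G →* H) (hf : Continuous f) :
    PiZero G →* PiZero H :=
  QuotientGroup.map _ _ f fun g hg ↦ by
    have hm := hf.image_connectedComponent_subset (1 : G) ⟨g, hg, rfl⟩
    rw [map_one] at hm
    exact hm

variable (A : Type u) [CStarAlgebra A]

/-- The unitary group `U_n(A)` of the matrix algebra `M_n(A)`. Its topology is that of entrywise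
convergence, which on `M_n(A)` is the topology of the C*-norm. -/
abbrev UnitaryMat (n : ℕ) : Type u := unitary (Matrix (Fin n) (Fin n) A)

variable {A}

/-- The `k × k` matrix `diag(a, 1)`, for an `n × n` matrix `a` and `n ≤ k`. -/
def padMatrix {n k : ℕ} (a : Matrix (Fin n) (Fin n) A) : Matrix (Fin k) (Fin k) A :=
  Matrix.of fun i j ↦
    if h : i.1 < n ∧ j.1 < n then a ⟨i, h.1⟩ ⟨j, h.2⟩ else if i = j then 1 else 0

theorem padMatrix_apply {n k : ℕ} (a : Matrix (Fin n) (Fin n) A) (i j : Fin k) :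
    padMatrix a i j =
      if h : i.1 < n ∧ j.1 < n then a ⟨i, h.1⟩ ⟨j, h.2⟩ else if i = j then 1 else 0 := rfl

theorem padMatrix_one {n k : ℕ} :
    padMatrix (1 : Matrix (Fin n) (Fin n) A) = (1 : Matrix (Fin k) (Fin k) A) := by
  ext i j
  simp only [padMatrix_apply, Matrix.one_apply, Fin.ext_iff]
  split_ifs <;> rfl

theorem padMatrix_star {n k : ℕ} (a : Matrix (Fin n) (Fin n) A) :
    (padMatrix (star a) : Matrix (Fin k) (Fin k) A) = star (padMatrix a) := by
  ext i j
  rw [Matrix.star_apply, padMatrix_apply, padMatrix_apply]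
  by_cases h : i.1 < n ∧ j.1 < n
  · rw [dif_pos h, dif_pos h.symm, Matrix.star_apply]
  · rw [dif_neg h, dif_neg fun h' ↦ h h'.symm]
    by_cases h2 : i = j
    · simp [h2]
    · simp [h2, Ne.symm h2]

theorem padMatrix_mul {n k : ℕ} (hnk : n ≤ k) (a b : Matrix (Fin n) (Fin n) A) :
    (padMatrix (a * b) : Matrix (Fin k) (Fin k) A) = padMatrix a * padMatrix b := by
  obtain ⟨m, rfl⟩ := Nat.exists_eq_add_of_le hnk
  ext i j
  rw [Matrix.mul_apply, Fin.sum_univ_add]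
  simp only [padMatrix_apply]
  refine Fin.addCases (fun i ↦ ?_) (fun i ↦ ?_) i <;>
  refine Fin.addCases (fun j ↦ ?_) (fun j ↦ ?_) j
  · have h1 (x : Fin m) : Fin.castAdd m i ≠ Fin.natAdd n x := by simp [Fin.ext_iff]; omega
    simp [Matrix.mul_apply, h1]
  · have h1 (x : Fin n) : Fin.castAdd m x ≠ Fin.natAdd n j := by simp [Fin.ext_iff]; omega
    have h2 (x : Fin m) : Fin.castAdd m i ≠ Fin.natAdd n x := by simp [Fin.ext_iff]; omega
    simp [h1, h2]
  · have h1 (x : Fin n) : Fin.natAdd n i ≠ Fin.castAdd m x := by simp [Fin.ext_iff]; omega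
    have h2 (x : Fin m) : Fin.natAdd n x ≠ Fin.castAdd m j := by simp [Fin.ext_iff]; omega
    simp [h1, h2]
  · have h1 (x : Fin n) : Fin.castAdd m x ≠ Fin.natAdd n j := by simp [Fin.ext_iff]; omega
    simp [h1]

theorem padMatrix_pad {n m k : ℕ} (hnm : n ≤ m) (a : Matrix (Fin n) (Fin n) A) :
    (padMatrix (padMatrix a : Matrix (Fin m) (Fin m) A) : Matrix (Fin k) (Fin k) A) =
      padMatrix a := by
  ext i j
  simp only [padMatrix_apply, Fin.ext_iff]
  split_ifs <;> first | rfl | omega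

theorem padMatrix_self {n : ℕ} (a : Matrix (Fin n) (Fin n) A) : padMatrix a = a := by
  ext i j
  simp [padMatrix_apply]

theorem continuous_padMatrix {n k : ℕ} :
    Continuous (padMatrix : Matrix (Fin n) (Fin n) A → Matrix (Fin k) (Fin k) A) := by
  refine continuous_matrix fun i j ↦ ?_
  simp only [padMatrix_apply]
  by_cases h : i.1 < n ∧ j.1 < n
  · simp only [h, and_self, dite_true]
    exact continuous_id.matrix_elem _ _
  · simp only [h, dite_false]
    exact continuous_const

variable (A) in
/-- The homomorphism `U_n(A) → U_k(A)`, `u ↦ diag(u, 1)`. -/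
def padUnitary {n k : ℕ} (h : n ≤ k) : UnitaryMat A n →* UnitaryMat A k where
  toFun u := ⟨padMatrix u.1, by
    have := u.2
    rw [Unitary.mem_iff] at this ⊢
    rw [← padMatrix_star, ← padMatrix_mul h, ← padMatrix_mul h, this.1, this.2, padMatrix_one]
    exact ⟨rfl, rfl⟩⟩
  map_one' := Subtype.ext padMatrix_one
  map_mul' u v := Subtype.ext (padMatrix_mul h u.1 v.1)

theorem continuous_padUnitary {n k : ℕ} (h : n ≤ k) : Continuous (padUnitary A h) :=
  Continuous.subtype_mk (continuous_padMatrix.comp continuous_subtype_val) _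

variable (A) in
/-- The connecting homomorphism `U_n(A) / U_n(A)_0 → U_k(A) / U_k(A)_0` induced by
`u ↦ diag(u, 1)`. -/
def kOneStep (n k : ℕ) (h : n ≤ k) : PiZero (UnitaryMat A n) →* PiZero (UnitaryMat A k) :=
  PiZero.map (padUnitary A h) (continuous_padUnitary h)

instance : DirectedSystem (fun n : ℕ ↦ PiZero (UnitaryMat A n)) (kOneStep A · · ·) where
  map_self n x := by
    induction x using QuotientGroup.induction_on with
    | H u => exact congrArg _ (Subtype.ext (padMatrix_self u.1))
  map_map n m k h h' x := by
    induction x using QuotientGroup.induction_on with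
    | H u => exact congrArg _ (Subtype.ext (padMatrix_pad h u.1))

variable (A) in
/-- The group `K₁(A)` of a unital C*-algebra: the direct limit of the groups `U_n(A) / U_n(A)_0`
along the maps `u ↦ diag(u, 1)`. -/
abbrev KOne : Type u := DirectLimit (fun n : ℕ ↦ PiZero (UnitaryMat A n)) (kOneStep A)

variable (A) in
/-- The identification of `U(A)` with `U_1(A)`. -/
def unitaryToMat : unitary A →* UnitaryMat A 1 where
  toFun u := ⟨Matrix.of fun _ _ ↦ u.1, by
    have := u.2
    rw [Unitary.mem_iff] at this ⊢
    constructor <;> ext i j <;>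
    simp [Matrix.mul_apply, Matrix.star_apply, Matrix.one_apply, Subsingleton.elim i j]⟩
  map_one' := Subtype.ext <| by
    ext i j
    simp [Subsingleton.elim i j]
  map_mul' u v := Subtype.ext <| by
    ext i j
    simp [Matrix.mul_apply]

variable (A) in
theorem continuous_unitaryToMat : Continuous (unitaryToMat A) :=
  Continuous.subtype_mk (continuous_matrix fun _ _ ↦ continuous_subtype_val) _

variable (A) in
/-- The canonical homomorphism `U(A) / U_0(A) → K₁(A)`. -/
def kOneMap : PiZero (unitary A) →* KOne A where
  toFun x := ⟦⟨1, PiZero.map (unitaryToMat A) (continuous_unitaryToMat A) x⟩⟧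
  map_one' := by rw [map_one]; exact (DirectLimit.one_def (f := kOneStep A) 1).symm
  map_mul' x y := by rw [map_mul]; exact (DirectLimit.mul_def (f := kOneStep A) 1 _ _).symm

variable (A) in
/-- `K₁`-injectivity: the canonical map `U(A) / U_0(A) → K₁(A)` is injective. -/
def IsKOneInjective : Prop := Function.Injective (kOneMap A)

end KOne

section Homotopy

variable {D : Type u} {B : Type v} [CStarAlgebra D] [CStarAlgebra B]

/-- Homotopy of unital *-homomorphisms `D → B`: a path of unital *-homomorphisms, continuous in the
topology of pointwise norm convergence, that joins them (equivalently, a unital *-homomorphism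
`D → C([0,1], B)` with these values at the end points). -/
def Homotopic (σ γ : D →⋆ₐ[ℂ] B) : Prop :=
  ∃ h : unitInterval → (D →⋆ₐ[ℂ] B), (∀ d, Continuous fun t ↦ h t d) ∧ h 0 = σ ∧ h 1 = γ

/-- The topology of pointwise norm convergence on the unital *-homomorphisms `D → B`. -/
abbrev pointNormTopology : TopologicalSpace (D →⋆ₐ[ℂ] B) :=
  TopologicalSpace.induced (fun σ d ↦ σ d) Pi.topologicalSpace

theorem homotopic_iff_joined (σ γ : D →⋆ₐ[ℂ] B) :
    Homotopic σ γ ↔ @Joined _ pointNormTopology σ γ := by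
  let _ : TopologicalSpace (D →⋆ₐ[ℂ] B) := pointNormTopology
  constructor
  · rintro ⟨h, hc, h0, h1⟩
    exact ⟨⟨⟨h, continuous_induced_rng.2 (continuous_pi hc)⟩, h0, h1⟩⟩
  · rintro ⟨p⟩
    exact ⟨p, fun d ↦ (continuous_apply d).comp (continuous_induced_dom.comp p.continuous),
      p.source, p.target⟩

variable (D B) in
/-- Homotopy is an equivalence relation. -/
def homotopySetoid : Setoid (D →⋆ₐ[ℂ] B) where
  r := Homotopic
  iseqv := by
    let _ : TopologicalSpace (D →⋆ₐ[ℂ] B) := pointNormTopology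
    refine ⟨fun σ ↦ ?_, fun {σ γ} h ↦ ?_, fun {σ γ τ} h h' ↦ ?_⟩
    · exact (homotopic_iff_joined σ σ).2 (Joined.refl σ)
    · exact (homotopic_iff_joined _ _).2 ((homotopic_iff_joined _ _).1 h).symm
    · exact (homotopic_iff_joined _ _).2
        (((homotopic_iff_joined _ _).1 h).trans ((homotopic_iff_joined _ _).1 h'))

variable (D B) in
/-- The set `[D, B]` of homotopy classes of unital *-homomorphisms from `D` to `B`. -/
def HomotopyClasses : Type (max u v) := Quotient (homotopySetoid D B)

end Homotopy
end CStarTensor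

end

/-! Let φ : D → D ⊗ D be the isomorphism, and let s, r be the legs d ⊗ 1 and 1 ⊗ d pulled back to D
along φ⁻¹. An Eckmann–Hilton argument (`rel_id_of_rel_symm_inclLeft`) shows that every unital
endomorphism of D is approximately unitarily equivalent to the identity, so some unitary u
approximately conjugates r to s. Multiplying u by the adjoint of μ(u), for a nearly central copy μ
of D in D, does not spoil this. As μ(u) is nearly a conjugate of u, the product is nearly a
commutator. Commutators die in K₁, so K₁-injectivity joins the corrected unitary to 1
(`exists_joined_halfFlip`).

Let E be separable, with E → E ⊗ D injective and an asymptotically central sequence of copies of D.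
The unitary paths above, transported to E ⊗ D, drive a one-sided approximate intertwining in
C([0,1], E ⊗ D). It perturbs the constant path e ⊗ 1 to one that starts at e ⊗ 1 and ends at an
isomorphism χ (`exists_iso_homotopic_inclLeft`). For E = D, Eckmann–Hilton applied to homotopy then
gives d ⊗ 1 ∼ 1 ⊗ d (`homotopic_inclLeft_inclRight`).

Given σ, τ : D → A ⊗ D, take E generated by their ranges and 1 ⊗ D. Then σ ∼ χ⁻¹(σ(·) ⊗ 1) ∼ χ⁻¹(1 ⊗
·), which no longer involves σ; likewise for τ.

The tensor products of *-homomorphisms and the flip come from a lifting criterion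
(`MinTensor.exists_lift`), whose norm estimate uses only vector functionals at elementary tensors.
-/

noncomputable section

namespace CStarTensor

open scoped ComplexOrder TensorProduct ENNReal

/-! ### Operator norms from the growth of powers on a total set. -/

section NormBound

variable {H : Type*} [NormedAddCommGroup H] [InnerProductSpace ℂ H] [CompleteSpace H]

/-- Cauchy–Schwarz for ⟨Tξ, Tξ⟩ = ⟨ξ, T²ξ⟩. Applied to Tⁿξ, it says that n ↦ ‖Tⁿξ‖ is log-convex. -/
theorem norm_sq_selfAdjoint_apply_le {T : H →L[ℂ] H} (hT : IsSelfAdjoint T) (ξ : H) :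
    ‖T ξ‖ ^ 2 ≤ ‖ξ‖ * ‖T (T ξ)‖ := by
  have h : inner ℂ (T ξ) (T ξ) = inner ℂ ξ (T (T ξ)) := by
    conv_lhs => rw [← hT.adjoint_eq]
    rw [ContinuousLinearMap.adjoint_inner_left, hT.adjoint_eq]
  have h2 := norm_inner_le_norm (𝕜 := ℂ) ξ (T (T ξ))
  rw [← h, inner_self_eq_norm_sq_to_K] at h2
  simpa using h2

/-- A self-adjoint operator is bounded by `c` on every vector on which its powers grow at most
like `c ^ n`. -/
theorem norm_apply_le_of_pow_bound {T : H →L[ℂ] H} (hT : IsSelfAdjoint T) {c C : ℝ} (hc : 0 ≤ c)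
    {ξ : H} (h : ∀ n : ℕ, ‖(T ^ n) ξ‖ ≤ C * c ^ n) : ‖T ξ‖ ≤ c * ‖ξ‖ := by
  by_contra! hlt
  have h0 : 0 < ‖ξ‖ := by
    rcases eq_or_ne ξ 0 with rfl | hne
    · simp at hlt
    · exact norm_pos_iff.2 hne
  have h1 : 0 < ‖T ξ‖ := lt_of_le_of_lt (by positivity) hlt
  set r := ‖T ξ‖ / ‖ξ‖ with hr
  have hr0 : 0 < r := by positivity
  have hcr : c < r := by rwa [hr, lt_div_iff₀ h0]
  -- By log-convexity the successive ratios never drop below the first one, r. Positivity is carried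
  -- along so that the induction can cancel.
  have key : ∀ n : ℕ, 0 < ‖(T ^ n) ξ‖ ∧ r * ‖(T ^ n) ξ‖ ≤ ‖(T ^ (n + 1)) ξ‖ := by
    intro n
    induction n with
    | zero => simpa [hr, div_mul_cancel₀ _ h0.ne'] using h0
    | succ n ih =>
      have h3 : 0 < ‖(T ^ (n + 1)) ξ‖ := lt_of_lt_of_le (mul_pos hr0 ih.1) ih.2
      refine ⟨h3, ?_⟩
      have h4 := norm_sq_selfAdjoint_apply_le hT ((T ^ n) ξ)
      have e1 : T ((T ^ n) ξ) = (T ^ (n + 1)) ξ := by rw [pow_succ']; rfl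
      have e2 : T ((T ^ (n + 1)) ξ) = (T ^ (n + 1 + 1)) ξ := by rw [pow_succ' T (n + 1)]; rfl
      rw [e1, e2] at h4
      have h5 : r * ‖(T ^ n) ξ‖ * ‖(T ^ (n + 1)) ξ‖ ≤ ‖(T ^ n) ξ‖ * ‖(T ^ (n + 1 + 1)) ξ‖ := by
        refine le_trans ?_ h4
        rw [sq]
        exact mul_le_mul_of_nonneg_right ih.2 (norm_nonneg _)
      refine le_of_mul_le_mul_left ?_ ih.1
      linarith
  have key2 : ∀ n : ℕ, r ^ n * ‖ξ‖ ≤ ‖(T ^ n) ξ‖ := by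
    intro n
    induction n with
    | zero => simp
    | succ n ih =>
      refine le_trans ?_ (key n).2
      rw [pow_succ', mul_assoc]
      exact mul_le_mul_of_nonneg_left ih hr0.le
  -- Growth at least like rⁿ and at most like cⁿ with c < r forces ξ = 0.
  have key3 : ∀ n : ℕ, ‖ξ‖ ≤ C * (c / r) ^ n := by
    intro n
    have h6 := (key2 n).trans (h n)
    rw [div_pow, ← mul_div_assoc, le_div_iff₀ (by positivity)]
    linarith
  have lim : Filter.Tendsto (fun n : ℕ ↦ C * (c / r) ^ n) Filter.atTop (nhds (C * 0)) :=
    (tendsto_pow_atTop_nhds_zero_of_lt_one (by positivity)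
      ((div_lt_one hr0).2 hcr)).const_mul C
  have := ge_of_tendsto' lim key3
  rw [mul_zero] at this
  linarith

/-- A self-adjoint operator has norm at most `c` if its powers grow at most like `c ^ n` on every
vector of a total set. -/
theorem opNorm_le_of_pow_bound {T : H →L[ℂ] H} (hT : IsSelfAdjoint T) {c : ℝ} (hc : 0 ≤ c)
    {S : Set H} (hS : Dense (Submodule.span ℂ S : Set H))
    (h : ∀ ξ ∈ S, ∃ C : ℝ, ∀ n : ℕ, ‖(T ^ n) ξ‖ ≤ C * c ^ n) : ‖T‖ ≤ c := by
  -- Because C may depend on the vector, the growth condition survives linear combinations; the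
  -- bound ‖Tξ‖ ≤ c‖ξ‖ on S alone would not.
  have hspan : ∀ ξ ∈ Submodule.span ℂ S, ∃ C : ℝ, ∀ n : ℕ, ‖(T ^ n) ξ‖ ≤ C * c ^ n := by
    intro ξ hξ
    induction hξ using Submodule.span_induction with
    | mem ξ hξ => exact h ξ hξ
    | zero => exact ⟨0, fun n ↦ by simp⟩
    | add x y _ _ hx hy =>
      obtain ⟨C, hC⟩ := hx
      obtain ⟨C', hC'⟩ := hy
      refine ⟨C + C', fun n ↦ ?_⟩
      rw [map_add, add_mul]
      exact (norm_add_le _ _).trans (add_le_add (hC n) (hC' n))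
    | smul a x _ hx =>
      obtain ⟨C, hC⟩ := hx
      refine ⟨‖a‖ * C, fun n ↦ ?_⟩
      rw [map_smul, norm_smul, mul_assoc]
      exact mul_le_mul_of_nonneg_left (hC n) (norm_nonneg _)
  refine T.opNorm_le_bound hc fun ξ ↦ ?_
  have hcl : IsClosed {ξ : H | ‖T ξ‖ ≤ c * ‖ξ‖} := isClosed_le (by fun_prop) (by fun_prop)
  have : (Set.univ : Set H) ⊆ {ξ : H | ‖T ξ‖ ≤ c * ‖ξ‖} := by
    rw [← hS.closure_eq]
    refine closure_minimal (fun η hη ↦ ?_) hcl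
    obtain ⟨C, hC⟩ := hspan η hη
    exact norm_apply_le_of_pow_bound hT hc hC
  exact this (Set.mem_univ ξ)

/-- Turns the growth of powers into a statement about the vector functional at ξ, the only quantity
controlled in the lifting criterion. -/
theorem norm_sq_pow_apply {T : H →L[ℂ] H} (hT : IsSelfAdjoint T) (n : ℕ) (ξ : H) :
    ‖(T ^ n) ξ‖ ^ 2 = ‖inner ℂ ξ ((T ^ (2 * n)) ξ)‖ := by
  have hn := hT.pow n
  have : inner ℂ ((T ^ n) ξ) ((T ^ n) ξ) = inner ℂ ξ ((T ^ (2 * n)) ξ) := by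
    conv_lhs => rw [← hn.adjoint_eq]
    rw [ContinuousLinearMap.adjoint_inner_left, hn.adjoint_eq, two_mul, pow_add]
    rfl
  rw [← this, inner_self_eq_norm_sq_to_K]
  simp

end NormBound

/-! ### Preliminaries on *-homomorphisms, elementary tensors and states. -/

section StarHom

variable {A B : Type*} [CStarAlgebra A] [CStarAlgebra B]

theorem norm_starHom_le (f : A →⋆ₐ[ℂ] B) (a : A) : ‖f a‖ ≤ ‖a‖ :=
  NonUnitalStarAlgHom.norm_apply_le f a

theorem continuous_starHom (f : A →⋆ₐ[ℂ] B) : Continuous f :=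
  AddMonoidHomClass.continuous_of_bound f 1 fun a ↦ by
    rw [one_mul]
    exact norm_starHom_le f a

end StarHom

section HilbertTensor

variable {H : Type u} {K : Type v} [NormedAddCommGroup H] [InnerProductSpace ℂ H]
  [NormedAddCommGroup K] [InnerProductSpace ℂ K]

variable (H K) in
/-- The unit elementary tensors in a Hilbert space tensor product. -/
def unitTensors : Set (HilbertTensor H K) :=
  {ξ | ∃ h : H, ∃ k : K, ‖h‖ = 1 ∧ ‖k‖ = 1 ∧ ξ = (h ⊗ₜ[ℂ] k : H ⊗[ℂ] K)}

theorem dense_span_unitTensors :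
    Dense (Submodule.span ℂ (unitTensors H K) : Set (HilbertTensor H K)) := by
  have h : ∀ x : H ⊗[ℂ] K,
      (x : HilbertTensor H K) ∈ Submodule.span ℂ (unitTensors H K) := by
    intro x
    induction x with
    | zero => exact zero_mem _
    | add x y hx hy =>
      rw [UniformSpace.Completion.coe_add]
      exact add_mem hx hy
    | tmul a b =>
      rcases eq_or_ne a 0 with rfl | ha
      · rw [TensorProduct.zero_tmul]
        exact zero_mem _
      rcases eq_or_ne b 0 with rfl | hb
      · rw [TensorProduct.tmul_zero]
        exact zero_mem _
      have ha' : (‖a‖ : ℂ) ≠ 0 := by simpa using ha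
      have hb' : (‖b‖ : ℂ) ≠ 0 := by simpa using hb
      have e : a ⊗ₜ[ℂ] b = ((‖a‖ : ℂ) * ‖b‖) •
          (((‖a‖ : ℂ)⁻¹ • a) ⊗ₜ[ℂ] ((‖b‖ : ℂ)⁻¹ • b)) := by
        rw [TensorProduct.smul_tmul_smul, smul_smul]
        field_simp
        simp
      rw [e, UniformSpace.Completion.coe_smul]
      refine Submodule.smul_mem _ _ (Submodule.subset_span ⟨_, _, ?_, ?_, rfl⟩)
      · rw [norm_smul]; simp [ha]
      · rw [norm_smul]; simp [hb]
  refine UniformSpace.Completion.denseRange_coe.mono ?_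
  rintro _ ⟨x, rfl⟩
  exact h x

theorem norm_coe_tmul (h : H) (k : K) :
    ‖((h ⊗ₜ[ℂ] k : H ⊗[ℂ] K) : HilbertTensor H K)‖ = ‖h‖ * ‖k‖ := by
  rw [UniformSpace.Completion.norm_coe, TensorProduct.norm_tmul]

theorem inner_opTensor_tmul (S : H →L[ℂ] H) (T : K →L[ℂ] K) (h : H) (k : K) :
    inner ℂ ((h ⊗ₜ[ℂ] k : H ⊗[ℂ] K) : HilbertTensor H K)
      (opTensor S T ((h ⊗ₜ[ℂ] k : H ⊗[ℂ] K) : HilbertTensor H K)) =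
      inner ℂ h (S h) * inner ℂ k (T k) := by
  rw [opTensor_coe, UniformSpace.Completion.inner_coe, TensorProduct.mapL_tmul,
    TensorProduct.inner_tmul]

end HilbertTensor

section States

variable {A : Type u} [CStarAlgebra A]

/-- The linear functional underlying a state. -/
def State.toLin (φ : State A) : A →ₗ[ℂ] ℂ :=
  letI := CStarAlgebra.spectralOrder A
  φ.1.toLinearMap

/-- A unital linear functional that is nonnegative on all `a⋆ a` is a state. -/
def State.ofLin (f : A →ₗ[ℂ] ℂ) (h1 : f 1 = 1) (hpos : ∀ a, 0 ≤ f (star a * a)) : State A :=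
  letI := CStarAlgebra.spectralOrder A
  letI := CStarAlgebra.spectralOrderedRing A
  ⟨PositiveLinearMap.mk₀ f fun x hx ↦ by
    obtain ⟨b, rfl⟩ := CStarAlgebra.nonneg_iff_eq_star_mul_self.1 hx
    exact hpos b, h1⟩

/-- The canonical cyclic vector of the GNS representation. -/
def State.cyc (φ : State A) : φ.Space :=
  letI := CStarAlgebra.spectralOrder A
  letI := CStarAlgebra.spectralOrderedRing A
  ((PositiveLinearMap.toPreGNS φ.1 1 : PositiveLinearMap.PreGNS φ.1) : PositiveLinearMap.GNS φ.1)

theorem State.inner_cyc (φ : State A) (a : A) :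
    inner ℂ φ.cyc (φ.rep a φ.cyc) = φ.toLin a := by
  let _ := CStarAlgebra.spectralOrder A
  let _ := CStarAlgebra.spectralOrderedRing A
  let ξ : PositiveLinearMap.PreGNS φ.1 := PositiveLinearMap.toPreGNS φ.1 1
  have h : φ.rep a φ.cyc = ((PositiveLinearMap.toPreGNS φ.1 a : PositiveLinearMap.PreGNS φ.1) :
      PositiveLinearMap.GNS φ.1) := by
    change PositiveLinearMap.gnsNonUnitalStarAlgHom φ.1 a (ξ : PositiveLinearMap.GNS φ.1) = _
    rw [PositiveLinearMap.gnsNonUnitalStarAlgHom_apply_coe]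
    simp [ξ]
  rw [h]
  change inner ℂ (ξ : PositiveLinearMap.GNS φ.1) _ = _
  rw [UniformSpace.Completion.inner_coe, PositiveLinearMap.preGNS_inner_def]
  simp [ξ]
  rfl

theorem State.toLin_one (φ : State A) : φ.toLin 1 = 1 := φ.2

theorem State.norm_cyc (φ : State A) : ‖φ.cyc‖ = 1 := by
  have h := φ.inner_cyc 1
  rw [map_one, φ.toLin_one, one_apply_eq_self] at h
  have h2 : ‖φ.cyc‖ ^ 2 = 1 := by rw [← inner_self_eq_norm_sq (𝕜 := ℂ), h]; simp
  nlinarith [norm_nonneg φ.cyc]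

/-- The vector state of a unit vector in a representation. -/
def vectorState {H : Type v} [NormedAddCommGroup H] [InnerProductSpace ℂ H] [CompleteSpace H]
    (π : A →⋆ₐ[ℂ] (H →L[ℂ] H)) (ξ : H) (hξ : ‖ξ‖ = 1) : State A :=
  State.ofLin
    { toFun a := inner ℂ ξ (π a ξ)
      map_add' a b := by rw [map_add, add_apply, inner_add_right]
      map_smul' c a := by rw [map_smul, smul_apply, inner_smul_right]; rfl }
    (by
      change inner ℂ ξ (π 1 ξ) = 1
      rw [map_one, one_apply_eq_self, inner_self_eq_norm_sq_to_K, hξ]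
      simp)
    (fun a ↦ by
      change 0 ≤ inner ℂ ξ (π (star a * a) ξ)
      rw [map_mul, map_star, ContinuousLinearMap.star_eq_adjoint, mul_apply_eq_comp,
        ContinuousLinearMap.adjoint_inner_right, inner_self_eq_norm_sq_to_K]
      positivity)

theorem vectorState_toLin {H : Type v} [NormedAddCommGroup H] [InnerProductSpace ℂ H]
    [CompleteSpace H] (π : A →⋆ₐ[ℂ] (H →L[ℂ] H)) (ξ : H) (hξ : ‖ξ‖ = 1) (a : A) :
    (vectorState π ξ hξ).toLin a = inner ℂ ξ (π a ξ) := rfl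

end States

/-! ### The minimal tensor product: density of elementary tensors and lifting of homomorphisms. -/

section ClosedAdjoin

variable {R : Type u} [CStarAlgebra R]

/-- A self-adjoint multiplicative monoid already has a *-algebra as its linear span. -/
theorem closedAdjoin_subset_closure_span {S : Set R} (h1 : (1 : R) ∈ S)
    (hmul : ∀ x ∈ S, ∀ y ∈ S, x * y ∈ S) (hstar : ∀ x ∈ S, star x ∈ S) :
    (closedAdjoin S : Set R) ⊆ closure (Submodule.span ℂ S : Set R) := by
  refine closure_mono fun x hx ↦ ?_
  have hx' : x ∈ Subalgebra.toSubmodule (StarAlgebra.adjoin ℂ S).toSubalgebra := hx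
  rw [StarAlgebra.adjoin_eq_span] at hx'
  have hU : S ∪ star S = S := by
    refine Set.union_eq_left.2 fun y hy ↦ ?_
    simpa using hstar _ hy
  rw [hU] at hx'
  refine Submodule.span_mono ?_ hx'
  let M : Submonoid R := ⟨⟨S, fun {a b} ha hb ↦ hmul a ha b hb⟩, h1⟩
  exact (Submonoid.closure_le (S := M)).2 (subset_refl _)

end ClosedAdjoin

namespace MinTensor

variable {A : Type*} {B : Type*} [CStarAlgebra A] [CStarAlgebra B]

/-- The representation of `A ⊗ B` on the Hilbert space `H_φ ⊗ H_ψ` of a pair of states. -/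
def blockRep (p : State A × State B) : MinTensor A B →⋆ₐ[ℂ]
    (HilbertTensor p.1.Space p.2.Space →L[ℂ] HilbertTensor p.1.Space p.2.Space) where
  toFun x := x.1.1 p
  map_one' := rfl
  map_mul' _ _ := rfl
  map_zero' := rfl
  map_add' _ _ := rfl
  commutes' _ := rfl
  map_star' _ := rfl

theorem blockRep_tmul (p : State A × State B) (a : A) (b : B) :
    blockRep p (tmul a b) = opTensor (p.1.rep a) (p.2.rep b) := by
  change opTensor (p.1.rep a) 1 * opTensor 1 (p.2.rep b) = _
  rw [← opTensor_mul, one_mul, mul_one]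

theorem norm_le_of_blockRep {x : MinTensor A B} {c : ℝ} (hc : 0 ≤ c)
    (h : ∀ p, ‖blockRep p x‖ ≤ c) : ‖x‖ ≤ c :=
  lp.norm_le_of_forall_le hc h

theorem norm_blockRep_le (p : State A × State B) (x : MinTensor A B) : ‖blockRep p x‖ ≤ ‖x‖ :=
  lp.norm_apply_le_norm ENNReal.top_ne_zero x.1 p

theorem continuous_blockRep (p : State A × State B) : Continuous (blockRep p) :=
  AddMonoidHomClass.continuous_of_bound (blockRep p) 1 fun x ↦ by
    rw [one_mul]
    exact norm_blockRep_le p x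

theorem exists_blockRep_ne_zero {x : MinTensor A B} (hx : x ≠ 0) : ∃ p, blockRep p x ≠ 0 := by
  by_contra! h
  exact hx (norm_le_zero_iff.1 (norm_le_of_blockRep le_rfl fun p ↦ by
    rw [h p]
    exact ContinuousLinearMap.opNorm_zero.le))

theorem ext_blockRep {x y : MinTensor A B} (h : ∀ p, blockRep p x = blockRep p y) : x = y :=
  Subtype.ext (lp.ext (funext h))

theorem tmul_mul (a a' : A) (b b' : B) : tmul a b * tmul a' b' = tmul (a * a') (b * b') := by
  refine ext_blockRep fun p ↦ ?_
  simp only [map_mul, blockRep_tmul, opTensor_mul]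

theorem star_tmul (a : A) (b : B) : star (tmul a b) = tmul (star a) (star b) := by
  refine ext_blockRep fun p ↦ ?_
  simp only [map_star, blockRep_tmul, opTensor_star]

theorem tmul_one_one : tmul (1 : A) (1 : B) = 1 := map_one (inclLeft A B)

variable (A B) in
/-- The unital *-homomorphism `B → A ⊗ B`, `b ↦ 1 ⊗ b`. -/
def inclRight : B →⋆ₐ[ℂ] MinTensor A B where
  toFun b := tmul 1 b
  map_one' := tmul_one_one
  map_mul' a b := by rw [tmul_mul, one_mul]
  map_zero' := Subtype.ext <| by
    change leftRep A B 1 * rightRep A B 0 = 0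
    rw [map_zero, mul_zero]
  map_add' a b := Subtype.ext <| by
    change leftRep A B 1 * rightRep A B (a + b) =
      leftRep A B 1 * rightRep A B a + leftRep A B 1 * rightRep A B b
    rw [map_add, mul_add]
  commutes' c := Subtype.ext <| by
    change leftRep A B 1 * rightRep A B (algebraMap ℂ B c) = algebraMap ℂ (BlockOp A B) c
    rw [map_one, one_mul]
    exact AlgHomClass.commutes (rightRep A B) c
  map_star' a := by rw [star_tmul, star_one]

theorem inclLeft_apply (a : A) : inclLeft A B a = tmul a 1 := rfl

theorem inclRight_apply (b : B) : inclRight A B b = tmul 1 b := rfl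

theorem inclLeft_mul_inclRight (a : A) (b : B) :
    inclLeft A B a * inclRight A B b = tmul a b := by
  rw [inclLeft_apply, inclRight_apply, tmul_mul, one_mul, mul_one]

theorem inclRight_mul_inclLeft (a : A) (b : B) :
    inclRight A B b * inclLeft A B a = tmul a b := by
  rw [inclLeft_apply, inclRight_apply, tmul_mul, one_mul, mul_one]

theorem dense_span_tmul :
    Dense (Submodule.span ℂ (Set.range fun p : A × B ↦ tmul p.1 p.2) : Set (MinTensor A B)) := by
  intro x
  let S : Set (BlockOp A B) := Set.range fun p : A × B ↦ leftRep A B p.1 * rightRep A B p.2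
  let T : StarSubalgebra ℂ (BlockOp A B) := closedAdjoin S
  have hx : (x.1 : BlockOp A B) ∈ closure (Submodule.span ℂ S : Set (BlockOp A B)) := by
    refine closedAdjoin_subset_closure_span ?_ ?_ ?_ x.2
    · exact ⟨(1, 1), congrArg Subtype.val (tmul_one_one (A := A) (B := B))⟩
    · rintro _ ⟨p, rfl⟩ _ ⟨q, rfl⟩
      exact ⟨(p.1 * q.1, p.2 * q.2), (congrArg Subtype.val (tmul_mul p.1 q.1 p.2 q.2)).symm⟩
    · rintro _ ⟨p, rfl⟩
      exact ⟨(star p.1, star p.2), (congrArg Subtype.val (star_tmul p.1 p.2)).symm⟩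
  refine (closure_subtype (x := (x : T))).2 ?_
  convert hx using 2
  have := Submodule.map_span (T.toSubalgebra.toSubmodule.subtype)
    (Set.range fun p : A × B ↦ (tmul p.1 p.2 : T))
  have h2 := congrArg (fun U : Submodule ℂ (BlockOp A B) ↦ (U : Set (BlockOp A B))) this
  have hr : Subtype.val '' (Set.range fun p : A × B ↦ (tmul p.1 p.2 : T)) = S :=
    (Set.range_comp _ _).symm
  exact h2.trans (congrArg (fun U : Set (BlockOp A B) ↦ ((Submodule.span ℂ U :
    Submodule ℂ (BlockOp A B)) : Set (BlockOp A B))) hr)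

/-- A closed property of elements of `A ⊗ B` that holds for elementary tensors and is preserved by
addition holds for all elements. -/
theorem induction_closed {P : MinTensor A B → Prop} (hcl : IsClosed {x | P x})
    (ht : ∀ a b, P (tmul a b)) (hadd : ∀ x y, P x → P y → P (x + y)) (x : MinTensor A B) :
    P x := by
  have hspan : ∀ y ∈ Submodule.span ℂ (Set.range fun p : A × B ↦ tmul p.1 p.2), P y := by
    intro y hy
    induction hy using Submodule.closure_induction with
    | zero =>
      have := ht 0 0
      rwa [← inclLeft_mul_inclRight, map_zero, zero_mul] at this
    | add y z _ _ hy hz => exact hadd y z hy hz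
    | smul_mem c y hy =>
      obtain ⟨p, rfl⟩ := hy
      have : c • tmul p.1 p.2 = tmul (c • p.1) p.2 := by
        rw [← inclLeft_mul_inclRight, ← inclLeft_mul_inclRight, map_smul, smul_mul_assoc]
      exact this ▸ ht _ _
  have := dense_span_tmul x
  exact closure_minimal hspan hcl this

theorem hom_ext {C : Type*} [CStarAlgebra C] {f g : MinTensor A B →⋆ₐ[ℂ] C}
    (h : ∀ a b, f (tmul a b) = g (tmul a b)) : f = g := by
  ext x
  refine induction_closed (P := fun x ↦ f x = g x) ?_ h (fun x y hx hy ↦ ?_) x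
  · exact isClosed_eq (continuous_starHom f) (continuous_starHom g)
  · rw [map_add, map_add, hx, hy]

section Lift

variable {A' : Type*} {B' : Type*} [CStarAlgebra A'] [CStarAlgebra B']

/-- The vector state of the tensor product of the cyclic vectors is the product state. -/
theorem inner_cyc_tmul (p : State A × State B) (a : A) (b : B) :
    inner ℂ ((p.1.cyc ⊗ₜ[ℂ] p.2.cyc : p.1.Space ⊗[ℂ] p.2.Space) :
        HilbertTensor p.1.Space p.2.Space)
      (blockRep p (tmul a b) ((p.1.cyc ⊗ₜ[ℂ] p.2.cyc : p.1.Space ⊗[ℂ] p.2.Space) :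
        HilbertTensor p.1.Space p.2.Space)) = p.1.toLin a * p.2.toLin b := by
  rw [blockRep_tmul, inner_opTensor_tmul, State.inner_cyc, State.inner_cyc]

/-- The condition under which commuting *-homomorphisms `F : A → A' ⊗ B'` and `G : B → A' ⊗ B'`
extend to `A ⊗ B`: the vector functionals of unit elementary tensors restrict to product states. -/
def IsProductCompatible (F : A →⋆ₐ[ℂ] MinTensor A' B') (G : B →⋆ₐ[ℂ] MinTensor A' B') : Prop :=
  ∀ p : State A' × State B', ∀ ξ ∈ unitTensors p.1.Space p.2.Space, ∃ q : State A × State B,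
    ∀ a b, inner ℂ ξ (blockRep p (F a * G b) ξ) = q.1.toLin a * q.2.toLin b

variable (F : A →⋆ₐ[ℂ] MinTensor A' B') (G : B →⋆ₐ[ℂ] MinTensor A' B')

/-- The closure of the graph of `a ⊗ b ↦ F(a) G(b)`. -/
def graphAlg : StarSubalgebra ℂ (MinTensor A B × MinTensor A' B') :=
  closedAdjoin (Set.range fun p : A × B ↦ (tmul p.1 p.2, F p.1 * G p.2))

variable {F G}

theorem norm_apply_le_of_unit {H : Type*} [NormedAddCommGroup H] [InnerProductSpace ℂ H]
    (T : H →L[ℂ] H) {ξ : H} (h : ‖ξ‖ = 1) : ‖inner ℂ ξ (T ξ)‖ ≤ ‖T‖ := by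
  refine (norm_inner_le_norm _ _).trans ?_
  have := T.le_opNorm ξ
  rw [h, mul_one] at this
  rwa [h, one_mul]

/-- At a unit elementary tensor ξ, the vector functional of the second coordinate is a product state
evaluated at the first coordinate, hence bounded by its norm. Such ξ are only total, so the operator
norm is recovered from the powers of z⋆z. -/
theorem norm_snd_le_of_mem_graphAlg (hc : ∀ a b, Commute (F a) (G b))
    (hFG : IsProductCompatible F G) {z : MinTensor A B × MinTensor A' B'}
    (hz : z ∈ graphAlg F G) : ‖z.2‖ ≤ ‖z.1‖ := by
  have key : ∀ p : State A' × State B', ∀ ξ ∈ unitTensors p.1.Space p.2.Space,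
      ∀ z ∈ graphAlg F G, ‖inner ℂ ξ (blockRep p z.2 ξ)‖ ≤ ‖z.1‖ := by
    intro p ξ hξ z hz
    obtain ⟨q, hq⟩ := hFG p ξ hξ
    have hz' := closedAdjoin_subset_closure_span
      (S := Set.range fun p : A × B ↦ (tmul p.1 p.2, F p.1 * G p.2))
      ⟨(1, 1), by simp only [map_one, mul_one, tmul_one_one]; rfl⟩
      (by
        rintro _ ⟨x, rfl⟩ _ ⟨y, rfl⟩
        refine ⟨(x.1 * y.1, x.2 * y.2), ?_⟩
        simp only [Prod.mk_mul_mk, tmul_mul, map_mul, Prod.mk.injEq, true_and]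
        rw [mul_assoc, mul_assoc, ← mul_assoc (F y.1), (hc y.1 x.2).eq, mul_assoc])
      (by
        rintro _ ⟨x, rfl⟩
        refine ⟨(star x.1, star x.2), ?_⟩
        refine Prod.ext (star_tmul _ _).symm ?_
        change F (star x.1) * G (star x.2) = star (F x.1 * G x.2)
        rw [(hc _ _).eq, star_mul, map_star, map_star]) hz
    set ζ : HilbertTensor q.1.Space q.2.Space :=
      ((q.1.cyc ⊗ₜ[ℂ] q.2.cyc : q.1.Space ⊗[ℂ] q.2.Space) : HilbertTensor q.1.Space q.2.Space)
      with hζ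
    -- Both sides are linear and continuous in z and agree on the generators of the graph, whose
    -- span is dense in it.
    have heq : inner ℂ ξ (blockRep p z.2 ξ) = inner ℂ ζ (blockRep q z.1 ζ) := by
      refine closure_minimal (t := {z : MinTensor A B × MinTensor A' B' |
        inner ℂ ξ (blockRep p z.2 ξ) = inner ℂ ζ (blockRep q z.1 ζ)}) ?_ ?_ hz'
      · intro y hy
        induction hy using Submodule.span_induction with
        | mem y hy =>
          obtain ⟨x, rfl⟩ := hy
          exact (hq _ _).trans (inner_cyc_tmul q x.1 x.2).symm
        | zero => simp
        | add x y _ _ hx hy =>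
          simp only [Set.mem_ofPred_eq, Prod.fst_add, Prod.snd_add, map_add, add_apply,
            inner_add_right] at hx hy ⊢
          rw [hx, hy]
        | smul c x _ hx =>
          simp only [Set.mem_ofPred_eq, Prod.smul_fst, Prod.smul_snd, map_smul, smul_apply,
            inner_smul_right] at hx ⊢
          rw [hx]
      · have h1 := continuous_blockRep p
        have h2 := continuous_blockRep q
        refine isClosed_eq ?_ ?_ <;> fun_prop
    rw [heq]
    refine (norm_apply_le_of_unit _ ?_).trans (norm_blockRep_le q z.1)
    rw [hζ, norm_coe_tmul, State.norm_cyc, State.norm_cyc, one_mul]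
  have hsa : ‖star z.2 * z.2‖ ≤ ‖star z.1 * z.1‖ := by
    refine norm_le_of_blockRep (norm_nonneg _) fun p ↦ ?_
    have hS : IsSelfAdjoint (blockRep p (star z.2 * z.2)) :=
      (IsSelfAdjoint.star_mul_self z.2).map (blockRep p)
    refine opNorm_le_of_pow_bound hS (norm_nonneg _) dense_span_unitTensors fun ξ hξ ↦ ⟨1, ?_⟩
    intro n
    rw [one_mul, ← sq_le_sq₀ (norm_nonneg _) (by positivity), norm_sq_pow_apply hS, ← pow_mul,
      mul_comm n 2]
    -- `norm_pow_le'` needs a positive exponent, since ‖1‖ = 1 is not available in a possibly zero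
    -- algebra.
    rcases Nat.eq_zero_or_pos n with rfl | hn
    · obtain ⟨h, k, hh, hk, rfl⟩ := hξ
      simp only [mul_zero, pow_zero, one_apply_eq_self, inner_self_eq_norm_sq_to_K, norm_coe_tmul,
        hh, hk]
      simp
    have hmem : (star z * z) ^ (2 * n) ∈ graphAlg F G := pow_mem (mul_mem (star_mem hz) hz) _
    have h2 := key p ξ hξ _ hmem
    rw [Prod.pow_snd, Prod.pow_fst, map_pow] at h2
    exact h2.trans (norm_pow_le' _ (by omega))
  rw [CStarRing.norm_star_mul_self, CStarRing.norm_star_mul_self] at hsa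
  exact (mul_self_le_mul_self_iff (norm_nonneg _) (norm_nonneg _)).2 hsa

/-- The norm inequality makes the first projection of the closed graph injective, hence isometric
with closed range. The range contains all elementary tensors, so the projection is invertible and
the graph is that of a homomorphism. -/
theorem exists_lift (hc : ∀ a b, Commute (F a) (G b)) (hFG : IsProductCompatible F G) :
    ∃ f : MinTensor A B →⋆ₐ[ℂ] MinTensor A' B', ∀ a b, f (tmul a b) = F a * G b := by
  let S : Set (MinTensor A B × MinTensor A' B') :=
    Set.range fun p : A × B ↦ (tmul p.1 p.2, F p.1 * G p.2)
  let Γ : StarSubalgebra ℂ (MinTensor A B × MinTensor A' B') := closedAdjoin S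
  let _ : CStarAlgebra Γ := inferInstanceAs (CStarAlgebra (closedAdjoin S))
  let p₁ : Γ →⋆ₐ[ℂ] MinTensor A B := (StarAlgHom.fst ℂ _ _).comp Γ.subtype
  let p₂ : Γ →⋆ₐ[ℂ] MinTensor A' B' := (StarAlgHom.snd ℂ _ _).comp Γ.subtype
  have hmem (a : A) (b : B) : (tmul a b, F a * G b) ∈ Γ := subset_closedAdjoin S ⟨(a, b), rfl⟩
  have hinj : Function.Injective p₁ := by
    refine (injective_iff_map_eq_zero p₁).2 fun z hz ↦ ?_
    have h1 : ‖z.1.2‖ ≤ ‖z.1.1‖ := norm_snd_le_of_mem_graphAlg hc hFG z.2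
    have h2 : z.1.1 = 0 := hz
    rw [h2, norm_zero, norm_le_zero_iff] at h1
    exact Subtype.ext (Prod.ext h2 h1)
  have hsurj : Function.Surjective p₁ := by
    have hcl : IsClosed (Set.range p₁) :=
      (NonUnitalStarAlgHom.isometry p₁ hinj).isClosedEmbedding.isClosed_range
    intro x
    refine induction_closed (P := fun x ↦ x ∈ Set.range p₁) hcl (fun a b ↦ ?_) ?_ x
    · exact ⟨⟨_, hmem a b⟩, rfl⟩
    · rintro _ _ ⟨y, rfl⟩ ⟨z, rfl⟩
      exact ⟨y + z, map_add _ _ _⟩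
  let e : Γ ≃⋆ₐ[ℂ] MinTensor A B := StarAlgEquiv.ofBijective p₁ ⟨hinj, hsurj⟩
  refine ⟨p₂.comp (e.symm : MinTensor A B →⋆ₐ[ℂ] Γ), fun a b ↦ ?_⟩
  have h : e.symm (tmul a b) = ⟨_, hmem a b⟩ := by
    rw [StarAlgEquiv.symm_apply_eq]
    rfl
  change p₂ (e.symm (tmul a b)) = _
  rw [h]
  rfl

end Lift

section Map

variable {A' : Type*} {B' : Type*} [CStarAlgebra A'] [CStarAlgebra B']

/-- The functional at h ⊗ k restricts to the product of the vector states of f at h and of g at k.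
-/
theorem exists_map (f : A →⋆ₐ[ℂ] A') (g : B →⋆ₐ[ℂ] B') :
    ∃ F : MinTensor A B →⋆ₐ[ℂ] MinTensor A' B', ∀ a b, F (tmul a b) = tmul (f a) (g b) := by
  obtain ⟨F, hF⟩ := exists_lift (F := (inclLeft A' B').comp f) (G := (inclRight A' B').comp g)
    (fun a b ↦ (inclLeft_mul_inclRight _ _).trans (inclRight_mul_inclLeft _ _).symm) (by
      rintro p _ ⟨h, k, hh, hk, rfl⟩
      refine ⟨(vectorState (p.1.rep.comp f) h hh, vectorState (p.2.rep.comp g) k hk),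
        fun a b ↦ ?_⟩
      simp only [StarAlgHom.comp_apply, inclLeft_mul_inclRight, blockRep_tmul,
        inner_opTensor_tmul, vectorState_toLin])
  exact ⟨F, fun a b ↦ (hF a b).trans (inclLeft_mul_inclRight _ _)⟩

/-- The *-homomorphism `f ⊗ g : A ⊗ B → A' ⊗ B'`. -/
def map (f : A →⋆ₐ[ℂ] A') (g : B →⋆ₐ[ℂ] B') : MinTensor A B →⋆ₐ[ℂ] MinTensor A' B' :=
  (exists_map f g).choose

@[simp]
theorem map_tmul (f : A →⋆ₐ[ℂ] A') (g : B →⋆ₐ[ℂ] B') (a : A) (b : B) :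
    map f g (tmul a b) = tmul (f a) (g b) := (exists_map f g).choose_spec a b

variable (A B) in
theorem exists_swap :
    ∃ F : MinTensor A B →⋆ₐ[ℂ] MinTensor B A, ∀ a b, F (tmul a b) = tmul b a := by
  obtain ⟨F, hF⟩ := exists_lift (F := inclRight B A) (G := inclLeft B A)
    (fun a b ↦ (inclRight_mul_inclLeft _ _).trans (inclLeft_mul_inclRight _ _).symm) (by
      rintro p _ ⟨h, k, hh, hk, rfl⟩
      refine ⟨(vectorState p.2.rep k hk, vectorState p.1.rep h hh), fun a b ↦ ?_⟩
      simp only [inclRight_mul_inclLeft, blockRep_tmul, inner_opTensor_tmul, vectorState_toLin]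
      exact mul_comm _ _)
  exact ⟨F, fun a b ↦ (hF a b).trans (inclRight_mul_inclLeft _ _)⟩

variable (A B) in
/-- The flip `A ⊗ B → B ⊗ A`. -/
def swap : MinTensor A B →⋆ₐ[ℂ] MinTensor B A := (exists_swap A B).choose

@[simp]
theorem swap_tmul (a : A) (b : B) : swap A B (tmul a b) = tmul b a :=
  (exists_swap A B).choose_spec a b

theorem swap_comp_swap : (swap B A).comp (swap A B) = StarAlgHom.id ℂ _ :=
  hom_ext fun a b ↦ by simp

theorem swap_comp_map (f : A →⋆ₐ[ℂ] A') (g : B →⋆ₐ[ℂ] B') :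
    (swap A' B').comp (map f g) = (map g f).comp (swap A B) :=
  hom_ext fun a b ↦ by simp

theorem map_comp_inclLeft (f : A →⋆ₐ[ℂ] A') (g : B →⋆ₐ[ℂ] B') :
    (map f g).comp (inclLeft A B) = (inclLeft A' B').comp f := by
  ext a
  simp [inclLeft_apply]

theorem map_comp_inclRight (f : A →⋆ₐ[ℂ] A') (g : B →⋆ₐ[ℂ] B') :
    (map f g).comp (inclRight A B) = (inclRight A' B').comp g := by
  ext a
  simp [inclRight_apply]

end Map

end MinTensor

open Filter Topology

/-! ### The Eckmann–Hilton argument. -/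

section EndomorphismRelation

variable {D : Type u} [CStarAlgebra D]

/-- Eckmann–Hilton argument: if a compatible equivalence relation on the endomorphisms of `D`
identifies `φ⁻¹ (d ⊗ 1)` with `d` for an isomorphism `φ : D → D ⊗ D`, it identifies all
endomorphisms. -/
theorem rel_id_of_rel_symm_inclLeft (φ : D ≃⋆ₐ[ℂ] MinTensor D D)
    {Q : (D →⋆ₐ[ℂ] D) → (D →⋆ₐ[ℂ] D) → Prop} (hQ : Equivalence Q)
    (hl : ∀ f g h : D →⋆ₐ[ℂ] D, Q g h → Q (f.comp g) (f.comp h))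
    (hr : ∀ f g h : D →⋆ₐ[ℂ] D, Q g h → Q (g.comp f) (h.comp f))
    (hs : Q ((φ.symm : MinTensor D D →⋆ₐ[ℂ] D).comp (MinTensor.inclLeft D D)) (StarAlgHom.id ℂ D))
    (y : D →⋆ₐ[ℂ] D) : Q y (StarAlgHom.id ℂ D) := by
  set ψ : MinTensor D D →⋆ₐ[ℂ] D := (φ.symm : MinTensor D D →⋆ₐ[ℂ] D)
  set φ' : D →⋆ₐ[ℂ] MinTensor D D := (φ : D →⋆ₐ[ℂ] MinTensor D D)
  have hψφ (x : D) : ψ (φ' x) = x := φ.symm_apply_apply x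
  have hφψ (x : MinTensor D D) : φ' (ψ x) = x := φ.apply_symm_apply x
  -- The second multiplication on endomorphisms: x ⊗ y transported to D. Below, b is the transported
  -- flip.
  let T (x y : D →⋆ₐ[ℂ] D) : D →⋆ₐ[ℂ] D := ψ.comp ((MinTensor.map x y).comp φ')
  let b : D →⋆ₐ[ℂ] D := ψ.comp ((MinTensor.swap D D).comp φ')
  -- T x y and x are intertwined exactly by d ↦ ψ(d ⊗ 1), which is related to the identity.
  have hT (x y : D →⋆ₐ[ℂ] D) : Q (T x y) x := by
    have h1 := hl (T x y) _ _ hs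
    have h2 : (T x y).comp (ψ.comp (MinTensor.inclLeft D D)) =
        (ψ.comp (MinTensor.inclLeft D D)).comp x := by
      ext d
      have := DFunLike.congr_fun (MinTensor.map_comp_inclLeft x y) d
      simp only [StarAlgHom.comp_apply] at this
      simp only [T, StarAlgHom.comp_apply, hφψ, this]
    rw [h2, StarAlgHom.comp_id] at h1
    exact hQ.trans (hQ.symm h1) (hr x _ _ hs)
  have hb : b.comp b = StarAlgHom.id ℂ D := by
    ext d
    have := DFunLike.congr_fun (MinTensor.swap_comp_swap (A := D) (B := D)) (φ' d)
    simp only [StarAlgHom.comp_apply] at this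
    simp only [b, StarAlgHom.comp_apply, hφψ, this]
    exact hψφ d
  have hbT : T y (StarAlgHom.id ℂ D) = b.comp ((T (StarAlgHom.id ℂ D) y).comp b) := by
    ext d
    have h1 := DFunLike.congr_fun (MinTensor.swap_comp_map (StarAlgHom.id ℂ D) y)
      (MinTensor.swap D D (φ' d))
    have h2 := DFunLike.congr_fun (MinTensor.swap_comp_swap (A := D) (B := D)) (φ' d)
    simp only [StarAlgHom.comp_apply] at h1 h2
    simp only [b, T, StarAlgHom.comp_apply, hφψ, h1, h2]
    rfl
  -- Conjugating T(id, y) ∼ id by the involution b gives T(y, id) ∼ id, while T(y, id) ∼ y.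
  have h3 := hl b _ _ (hr b _ _ (hT (StarAlgHom.id ℂ D) y))
  rw [← hbT, StarAlgHom.id_comp, hb] at h3
  exact hQ.trans (hQ.symm (hT y _)) h3

end EndomorphismRelation

/-! ### Approximate unitary equivalence. -/

section ApproxUnitary

variable {A B C : Type*} [CStarAlgebra A] [CStarAlgebra B] [CStarAlgebra C]

/-- The image of a unitary under a unital *-homomorphism. -/
def mapUnitary (f : A →⋆ₐ[ℂ] B) (u : unitary A) : unitary B := ⟨f u, Unitary.map_mem f u.2⟩

@[simp]
theorem coe_mapUnitary (f : A →⋆ₐ[ℂ] B) (u : unitary A) : (mapUnitary f u : B) = f u := rfl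

/-- Conjugation by a unitary. -/
def conjHom (u : unitary A) : A →⋆ₐ[ℂ] A := (Unitary.conjStarAlgAut ℂ A u : A →⋆ₐ[ℂ] A)

theorem conjHom_apply (u : unitary A) (a : A) : conjHom u a = u * a * star (u : A) := rfl

theorem norm_conj (u : unitary A) (a : A) : ‖(u : A) * a * star (u : A)‖ = ‖a‖ := by
  rw [← Unitary.coe_star, CStarRing.norm_mul_coe_unitary, CStarRing.norm_coe_unitary_mul]

theorem norm_conj_sub (u : unitary A) (a b : A) :
    ‖(u : A) * a * star (u : A) - b‖ = ‖star (u : A) * b * u - a‖ := by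
  have h : (u : A) * a * star (u : A) - b =
      -((u : A) * (star (u : A) * b * u - a) * star (u : A)) := by
    have h1 : (u : A) * star (u : A) = 1 := Unitary.coe_mul_star_self u
    have : (u : A) * (star (u : A) * b * u) * star (u : A) =
        ((u : A) * star (u : A)) * b * (u * star (u : A)) := by noncomm_ring
    rw [mul_sub, sub_mul, this, h1]
    noncomm_ring
  rw [h, norm_neg, norm_conj]

theorem ApproxUnitarilyEquiv.refl (σ : A →⋆ₐ[ℂ] B) : ApproxUnitarilyEquiv σ σ :=
  ⟨fun _ ↦ 1, fun a ↦ by simp⟩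

theorem ApproxUnitarilyEquiv.symm {σ γ : A →⋆ₐ[ℂ] B} (h : ApproxUnitarilyEquiv σ γ) :
    ApproxUnitarilyEquiv γ σ := by
  obtain ⟨u, hu⟩ := h
  refine ⟨fun n ↦ star (u n), fun a ↦ ?_⟩
  simpa only [Unitary.coe_star, star_star, ← norm_conj_sub] using hu a

theorem ApproxUnitarilyEquiv.trans {σ γ τ : A →⋆ₐ[ℂ] B} (h : ApproxUnitarilyEquiv σ γ)
    (h' : ApproxUnitarilyEquiv γ τ) : ApproxUnitarilyEquiv σ τ := by
  obtain ⟨u, hu⟩ := h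
  obtain ⟨v, hv⟩ := h'
  refine ⟨fun n ↦ v n * u n, fun a ↦ ?_⟩
  refine squeeze_zero (fun _ ↦ norm_nonneg _) (fun n ↦ ?_) (by simpa using (hu a).add (hv a))
  have : ((v n * u n : unitary B) : B) * σ a * star ((v n * u n : unitary B) : B) - τ a =
      (v n : B) * ((u n : B) * σ a * star (u n : B) - γ a) * star (v n : B) +
        ((v n : B) * γ a * star (v n : B) - τ a) := by
    rw [Submonoid.coe_mul, star_mul]
    noncomm_ring
  rw [this]
  exact (norm_add_le _ _).trans (by rw [norm_conj])

theorem ApproxUnitarilyEquiv.comp_left {σ γ : A →⋆ₐ[ℂ] B} (f : B →⋆ₐ[ℂ] C)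
    (h : ApproxUnitarilyEquiv σ γ) : ApproxUnitarilyEquiv (f.comp σ) (f.comp γ) := by
  obtain ⟨u, hu⟩ := h
  refine ⟨fun n ↦ mapUnitary f (u n), fun a ↦ squeeze_zero (fun _ ↦ norm_nonneg _) (fun n ↦ ?_)
    (hu a)⟩
  refine le_trans (le_of_eq ?_) (norm_starHom_le f _)
  simp only [map_sub, map_mul, map_star, coe_mapUnitary, StarAlgHom.comp_apply]

theorem ApproxUnitarilyEquiv.comp_right {σ γ : A →⋆ₐ[ℂ] B} (f : C →⋆ₐ[ℂ] A)
    (h : ApproxUnitarilyEquiv σ γ) : ApproxUnitarilyEquiv (σ.comp f) (γ.comp f) := by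
  obtain ⟨u, hu⟩ := h
  exact ⟨u, fun a ↦ hu (f a)⟩

variable {D : Type u} [CStarAlgebra D]

theorem approxUnitarilyEquiv_symm_inclLeft {φ : D ≃⋆ₐ[ℂ] MinTensor D D}
    (hφ : ApproxUnitarilyEquiv (φ : D →⋆ₐ[ℂ] MinTensor D D) (MinTensor.inclLeft D D)) :
    ApproxUnitarilyEquiv ((φ.symm : MinTensor D D →⋆ₐ[ℂ] D).comp (MinTensor.inclLeft D D))
      (StarAlgHom.id ℂ D) := by
  have h := (hφ.comp_left (φ.symm : MinTensor D D →⋆ₐ[ℂ] D)).symm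
  convert h
  ext d
  exact (φ.symm_apply_apply d).symm

theorem approxUnitarilyEquiv_id {φ : D ≃⋆ₐ[ℂ] MinTensor D D}
    (hφ : ApproxUnitarilyEquiv (φ : D →⋆ₐ[ℂ] MinTensor D D) (MinTensor.inclLeft D D))
    (y : D →⋆ₐ[ℂ] D) : ApproxUnitarilyEquiv y (StarAlgHom.id ℂ D) :=
  rel_id_of_rel_symm_inclLeft φ ⟨.refl, .symm, .trans⟩ (fun f _ _ ↦ .comp_left f)
    (fun f _ _ ↦ .comp_right f) (approxUnitarilyEquiv_symm_inclLeft hφ) y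

/-- Conjugation by unitaries preserves norms, so in the limit d ⊗ 1 = 0 forces φ(d) = 0. -/
theorem inclLeft_injective_of_approxUnitarilyEquiv {φ : D ≃⋆ₐ[ℂ] MinTensor D D}
    (hφ : ApproxUnitarilyEquiv (φ : D →⋆ₐ[ℂ] MinTensor D D) (MinTensor.inclLeft D D)) :
    Function.Injective (MinTensor.inclLeft D D) := by
  refine (injective_iff_map_eq_zero _).2 fun d hd ↦ ?_
  obtain ⟨u, hu⟩ := hφ
  have h := hu d
  simp only [hd, sub_zero, norm_conj] at h
  have h2 := tendsto_nhds_unique h tendsto_const_nhds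
  exact (map_eq_zero_iff φ φ.injective).1 (norm_eq_zero.1 h2.symm)

end ApproxUnitary

/-! ### Asymptotically central sequences. -/

section AsympCentral

variable {D E : Type*} [CStarAlgebra D] [CStarAlgebra E]

/-- An element asymptotically commutes with the images of the unit ball of `D`. -/
def AsympCommutes (ψ : ℕ → D →⋆ₐ[ℂ] E) (e : E) : Prop :=
  ∀ ε : ℝ, 0 < ε → ∀ᶠ n in atTop, ∀ x, ‖ψ n x * e - e * ψ n x‖ ≤ ε * ‖x‖

/-- A sequence of unital *-homomorphisms that asymptotically commute with every element of the
target. -/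
def AsympCentral (ψ : ℕ → D →⋆ₐ[ℂ] E) : Prop := ∀ e, AsympCommutes ψ e

theorem norm_commutator_le {R : Type*} [NormedRing R] (x y z : R) (h : x * z = z * x) :
    ‖x * y - y * x‖ ≤ 2 * ‖x‖ * ‖y - z‖ := by
  have : x * y - y * x = x * (y - z) - (y - z) * x := by
    rw [mul_sub, sub_mul, h]
    abel
  rw [this]
  refine (norm_sub_le _ _).trans ?_
  have h1 := norm_mul_le x (y - z)
  have h2 := norm_mul_le (y - z) x
  linarith

theorem isClosed_asympCommutes (ψ : ℕ → D →⋆ₐ[ℂ] E) : IsClosed {e | AsympCommutes ψ e} := by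
  refine isClosed_of_closure_subset fun e he ε hε ↦ ?_
  obtain ⟨e', he', hd⟩ := Metric.mem_closure_iff.1 he (ε / 4) (by positivity)
  filter_upwards [he' (ε / 2) (by positivity)] with n hn x
  have h1 : ψ n x * e - e * ψ n x =
      (ψ n x * e' - e' * ψ n x) + (ψ n x * (e - e') - (e - e') * ψ n x) := by noncomm_ring
  rw [h1]
  have h2 := norm_commutator_le (ψ n x) (e - e') 0 (by simp)
  rw [sub_zero] at h2
  rw [dist_eq_norm] at hd
  have h3 := norm_starHom_le (ψ n) x
  have h4 : 2 * ‖ψ n x‖ * ‖e - e'‖ ≤ 2 * ‖x‖ * (ε / 4) := by gcongr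
  refine (norm_add_le _ _).trans ?_
  have := hn x
  linarith

theorem AsympCommutes.add {ψ : ℕ → D →⋆ₐ[ℂ] E} {e e' : E} (h : AsympCommutes ψ e)
    (h' : AsympCommutes ψ e') : AsympCommutes ψ (e + e') := by
  intro ε hε
  filter_upwards [h (ε / 2) (by positivity), h' (ε / 2) (by positivity)] with n h1 h2 x
  have : ψ n x * (e + e') - (e + e') * ψ n x =
      (ψ n x * e - e * ψ n x) + (ψ n x * e' - e' * ψ n x) := by noncomm_ring
  rw [this]
  refine (norm_add_le _ _).trans ?_
  have := h1 x
  have := h2 x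
  linarith

/-- The two legs of D ⊗ D ≅ D commute. Conjugating by u n carries the left leg of d close to d, so
it carries the right leg to a copy of D nearly commuting with d. -/
theorem exists_asympCentral {φ : D ≃⋆ₐ[ℂ] MinTensor D D}
    (hφ : ApproxUnitarilyEquiv (φ : D →⋆ₐ[ℂ] MinTensor D D) (MinTensor.inclLeft D D)) :
    ∃ μ : ℕ → D →⋆ₐ[ℂ] D, AsympCentral μ := by
  obtain ⟨u, hu⟩ := approxUnitarilyEquiv_symm_inclLeft hφ
  refine ⟨fun n ↦ (conjHom (u n)).comp
    ((φ.symm : MinTensor D D →⋆ₐ[ℂ] D).comp (MinTensor.inclRight D D)), fun d ε hε ↦ ?_⟩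
  have h := (hu d).eventually (gt_mem_nhds (half_pos hε))
  filter_upwards [h] with n hn x
  set μ := (conjHom (u n)).comp
    ((φ.symm : MinTensor D D →⋆ₐ[ℂ] D).comp (MinTensor.inclRight D D))
  set s := (conjHom (u n)).comp
    ((φ.symm : MinTensor D D →⋆ₐ[ℂ] D).comp (MinTensor.inclLeft D D))
  have h1 : μ x * s d = s d * μ x := by
    simp only [μ, s, StarAlgHom.comp_apply, ← map_mul, MinTensor.inclRight_mul_inclLeft,
      MinTensor.inclLeft_mul_inclRight]
  refine (norm_commutator_le _ _ (s d) h1).trans ?_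
  have h2 : ‖d - s d‖ < ε / 2 := by
    rw [norm_sub_rev]
    exact hn
  have h3 := norm_starHom_le μ x
  have h4 : 2 * ‖μ x‖ * ‖d - s d‖ ≤ 2 * ‖x‖ * (ε / 2) := by gcongr
  linarith

theorem MinTensor.norm_tmul_le {A B : Type*} [CStarAlgebra A] [CStarAlgebra B] (a : A) (b : B) :
    ‖MinTensor.tmul a b‖ ≤ ‖a‖ * ‖b‖ := by
  rw [← MinTensor.inclLeft_mul_inclRight]
  exact (norm_mul_le _ _).trans (mul_le_mul (norm_starHom_le _ _) (norm_starHom_le _ _)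
    (norm_nonneg _) (norm_nonneg _))

theorem MinTensor.tmul_sub {A B : Type*} [CStarAlgebra A] [CStarAlgebra B] (a : A) (b b' : B) :
    MinTensor.tmul a (b - b') = MinTensor.tmul a b - MinTensor.tmul a b' := by
  simp only [← MinTensor.inclLeft_mul_inclRight, map_sub, mul_sub]

theorem MinTensor.sub_tmul {A B : Type*} [CStarAlgebra A] [CStarAlgebra B] (a a' : A) (b : B) :
    MinTensor.tmul (a - a') b = MinTensor.tmul a b - MinTensor.tmul a' b := by
  simp only [← MinTensor.inclLeft_mul_inclRight, map_sub, sub_mul]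

/-- The copies live in the second leg and commute with the first; asymptotic commutation is closed
under sums and limits, so elementary tensors suffice. -/
theorem AsympCentral.inclRight_comp (A : Type*) [CStarAlgebra A] {μ : ℕ → D →⋆ₐ[ℂ] E}
    (hμ : AsympCentral μ) : AsympCentral fun n ↦ (MinTensor.inclRight A E).comp (μ n) := by
  refine MinTensor.induction_closed (isClosed_asympCommutes _) (fun a b ε hε ↦ ?_)
    fun x y ↦ .add
  filter_upwards [hμ b (ε / (‖a‖ + 1)) (by positivity)] with n hn x
  rw [StarAlgHom.comp_apply, MinTensor.inclRight_apply, MinTensor.tmul_mul, MinTensor.tmul_mul,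
    one_mul, mul_one, ← MinTensor.tmul_sub]
  refine (MinTensor.norm_tmul_le _ _).trans ?_
  calc ‖a‖ * ‖μ n x * b - b * μ n x‖ ≤ ‖a‖ * (ε / (‖a‖ + 1) * ‖x‖) := by gcongr; exact hn x
    _ = (‖a‖ / (‖a‖ + 1)) * (ε * ‖x‖) := by ring
    _ ≤ 1 * (ε * ‖x‖) := by
      gcongr
      exact (div_le_one (by positivity)).2 (by linarith)
    _ = ε * ‖x‖ := one_mul _

end AsympCentral

/-! ### Commutators of unitaries are trivial in K₁. -/

section KOne

variable {A : Type u} [CStarAlgebra A]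

/-- The rotation matrix with angle `t` in `M₂(A)`. -/
def rotationMatrix (A : Type u) [CStarAlgebra A] (t : ℝ) : Matrix (Fin 2) (Fin 2) A :=
  !![Real.cos t • 1, -(Real.sin t • 1); Real.sin t • 1, Real.cos t • 1]

theorem rotationMatrix_mem_unitary (t : ℝ) : rotationMatrix A t ∈ unitary _ := by
  have h1 : Real.cos t * Real.cos t + Real.sin t * Real.sin t = 1 := by
    rw [← sq, ← sq, Real.cos_sq_add_sin_sq]
  have h2 : Real.sin t * Real.sin t + Real.cos t * Real.cos t = 1 := by
    rw [← sq, ← sq, Real.sin_sq_add_cos_sq]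
  rw [Unitary.mem_iff]
  constructor <;> ext i j <;> fin_cases i <;> fin_cases j <;>
    simp [rotationMatrix, Matrix.mul_apply, Matrix.star_apply, Fin.sum_univ_two, smul_smul,
      ← add_smul, h1, h2, mul_comm]

/-- The rotation by the angle `t` in `U₂(A)`. -/
def rotation (A : Type u) [CStarAlgebra A] (t : ℝ) : UnitaryMat A 2 :=
  ⟨rotationMatrix A t, rotationMatrix_mem_unitary t⟩

theorem continuous_rotation : Continuous (rotation A) := by
  refine Continuous.subtype_mk (continuous_matrix fun i j ↦ ?_) _
  fin_cases i <;> fin_cases j <;> simp [rotationMatrix] <;> fun_prop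

theorem rotation_zero : rotation A 0 = 1 := by
  refine Subtype.ext ?_
  ext i j
  fin_cases i <;> fin_cases j <;> simp [rotation, rotationMatrix]

theorem rotation_mem_connectedComponent (t : ℝ) :
    rotation A t ∈ Subgroup.connectedComponentOfOne (UnitaryMat A 2) := by
  have h : IsPreconnected (Set.range (rotation A)) := isPreconnected_range continuous_rotation
  exact h.subset_connectedComponent ⟨0, rotation_zero⟩ ⟨t, rfl⟩

/-- The unitary matrix `diag(u, 1)` in `U₂(A)`. -/
def diagLeft (u : unitary A) : UnitaryMat A 2 := padUnitary A one_le_two (unitaryToMat A u)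

/-- The unitary matrix `diag(1, u)` in `U₂(A)`. -/
def diagRight (u : unitary A) : UnitaryMat A 2 :=
  rotation A (Real.pi / 2) * diagLeft u * (rotation A (Real.pi / 2))⁻¹

theorem coe_diagLeft (u : unitary A) : (diagLeft u).1 = !![(u : A), 0; 0, 1] := by
  ext i j
  fin_cases i <;> fin_cases j <;>
    simp [diagLeft, padUnitary, padMatrix, unitaryToMat]

theorem coe_diagRight (u : unitary A) : (diagRight u).1 = !![1, 0; 0, (u : A)] := by
  have h : (diagRight u).1 = rotationMatrix A (Real.pi / 2) * (diagLeft u).1 *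
      star (rotationMatrix A (Real.pi / 2)) := rfl
  rw [h, coe_diagLeft]
  ext i j
  fin_cases i <;> fin_cases j <;>
    simp [rotationMatrix, Matrix.mul_apply, Matrix.star_apply, Fin.sum_univ_two]

theorem commute_diagRight_diagLeft (u v : unitary A) :
    diagRight u * diagLeft v = diagLeft v * diagRight u := by
  refine Subtype.ext ?_
  rw [Submonoid.coe_mul, Submonoid.coe_mul, coe_diagLeft, coe_diagRight]
  ext i j
  fin_cases i <;> fin_cases j <;> simp [Matrix.mul_apply, Fin.sum_univ_two]

/-- Rotating by the angle π/2 exchanges the diagonal entries, and rotations are connected to 1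
through the other angles. -/
theorem mk_diagRight (u : unitary A) :
    (diagRight u : PiZero (UnitaryMat A 2)) = diagLeft u := by
  have h : (rotation A (Real.pi / 2) : PiZero (UnitaryMat A 2)) = 1 :=
    (QuotientGroup.eq_one_iff _).2 (rotation_mem_connectedComponent _)
  rw [diagRight, QuotientGroup.mk_mul, QuotientGroup.mk_mul, QuotientGroup.mk_inv, h, one_mul,
    inv_one, mul_one]

/-- In U₂ modulo its identity component, diag(u, 1) may be replaced by diag(1, u), which commutes
with diag(v, 1). Stage 2 of the limit therefore already kills the commutator. -/
theorem kOneMap_commutator (u v : unitary A) :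
    kOneMap A ((u * v * u⁻¹ * v⁻¹ : unitary A) : PiZero (unitary A)) = 1 := by
  have h : ((diagLeft (u * v * u⁻¹ * v⁻¹) : UnitaryMat A 2) : PiZero (UnitaryMat A 2)) = 1 := by
    have e : diagLeft (u * v * u⁻¹ * v⁻¹) =
        diagLeft u * diagLeft v * (diagLeft u)⁻¹ * (diagLeft v)⁻¹ := by
      simp only [diagLeft, map_mul, map_inv]
    rw [e, QuotientGroup.mk_mul, QuotientGroup.mk_mul, QuotientGroup.mk_mul, QuotientGroup.mk_inv,
      QuotientGroup.mk_inv, ← mk_diagRight u, ← QuotientGroup.mk_mul, commute_diagRight_diagLeft,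
      QuotientGroup.mk_mul, mul_inv_cancel_right, mul_inv_cancel]
  rw [DirectLimit.one_def (f := kOneStep A) 2, ← h]
  exact DirectLimit.eq_of_le (f := kOneStep A) ⟨1, _⟩ 2 one_le_two

/-- K₁-injectivity puts the commutator in the connected component of 1, which for a unitary group is
the path component. -/
theorem joined_one_commutator (hK : IsKOneInjective A) (u v : unitary A) :
    Joined 1 (u * v * u⁻¹ * v⁻¹) := by
  have h : ((u * v * u⁻¹ * v⁻¹ : unitary A) : PiZero (unitary A)) = 1 :=
    hK ((kOneMap_commutator u v).trans (map_one (kOneMap A)).symm)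
  have h2 : u * v * u⁻¹ * v⁻¹ ∈ connectedComponent (1 : unitary A) :=
    (QuotientGroup.eq_one_iff _).1 h
  rw [← pathComponent_eq_connectedComponent] at h2
  exact h2

end KOne

/-! ### The approximate half-flip by unitaries connected to the unit. -/

section HalfFlip

variable {D : Type u} [CStarAlgebra D]

theorem norm_unitary_le_one (u : unitary D) : ‖(u : D)‖ ≤ 1 := by
  rcases subsingleton_or_nontrivial D with h | h
  · rw [Subsingleton.elim (u : D) 0, norm_zero]
    exact zero_le_one
  · exact (CStarRing.norm_coe_unitary u).le

theorem norm_unitary_conj_sub_le (c w : unitary D) (x : D) :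
    ‖(c : D) * x * star (c : D) - (w : D) * x * star (w : D)‖ ≤ 2 * ‖(c : D) - w‖ * ‖x‖ := by
  have h : (c : D) * x * star (c : D) - (w : D) * x * star (w : D) =
      ((c : D) - w) * x * star (c : D) + (w : D) * (x * star ((c : D) - w)) := by
    rw [star_sub]
    noncomm_ring
  rw [h]
  refine (norm_add_le _ _).trans ?_
  rw [← Unitary.coe_star, CStarRing.norm_mul_coe_unitary, CStarRing.norm_coe_unitary_mul]
  have h1 := norm_mul_le ((c : D) - w) x
  have h2 := norm_mul_le x (star ((c : D) - w))
  rw [norm_star] at h2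
  linarith

/-- The two embeddings of `D` into `D ⊗ D ≅ D` are approximately conjugate by unitaries in the
path component of the unit. -/
theorem exists_joined_halfFlip (hK : IsKOneInjective D) {φ : D ≃⋆ₐ[ℂ] MinTensor D D}
    (hφ : ApproxUnitarilyEquiv (φ : D →⋆ₐ[ℂ] MinTensor D D) (MinTensor.inclLeft D D))
    (F : Finset D) {ε : ℝ} (hε : 0 < ε) :
    ∃ c : unitary D, Joined 1 c ∧ ∀ d ∈ F,
      ‖star (c : D) * φ.symm (MinTensor.inclRight D D d) * (c : D) -
        φ.symm (MinTensor.inclLeft D D d)‖ ≤ ε := by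
  set s : D →⋆ₐ[ℂ] D := (φ.symm : MinTensor D D →⋆ₐ[ℂ] D).comp (MinTensor.inclLeft D D)
  set r : D →⋆ₐ[ℂ] D := (φ.symm : MinTensor D D →⋆ₐ[ℂ] D).comp (MinTensor.inclRight D D)
  change ∃ c : unitary D, Joined 1 c ∧ ∀ d ∈ F,
    ‖star (c : D) * r d * (c : D) - s d‖ ≤ ε
  obtain ⟨M, hM0, hM⟩ : ∃ M : ℝ, 0 < M ∧ ∀ d ∈ F, ‖d‖ ≤ M := by
    refine ⟨∑ d ∈ F, ‖d‖ + 1, by positivity, fun d hd ↦ ?_⟩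
    have := Finset.single_le_sum (f := fun d ↦ ‖d‖) (fun _ _ ↦ norm_nonneg _) hd
    linarith
  have hsr : ApproxUnitarilyEquiv r s :=
    (approxUnitarilyEquiv_id hφ r).trans (approxUnitarilyEquiv_id hφ s).symm
  obtain ⟨un, hun⟩ := hsr
  obtain ⟨u, hu⟩ : ∃ u : unitary D, ∀ d ∈ F, ‖(u : D) * r d * star (u : D) - s d‖ ≤ ε / 3 := by
    have h : ∀ᶠ n in atTop, ∀ d ∈ F, ‖(un n : D) * r d * star (un n : D) - s d‖ < ε / 3 :=
      (eventually_all_finset F).2 fun d _ ↦ (hun d).eventually (gt_mem_nhds (by positivity))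
    obtain ⟨n, hn⟩ := h.exists
    exact ⟨un n, fun d hd ↦ (hn d hd).le⟩
  obtain ⟨μs, hμs⟩ := exists_asympCentral hφ
  -- The copy μ is chosen after u, so central that μ(u) almost fixes s(d).
  obtain ⟨μ, hμ⟩ : ∃ μ : D →⋆ₐ[ℂ] D, ∀ d ∈ F, ‖star (μ u) * s d * μ u - s d‖ ≤ ε / 3 := by
    have h : ∀ᶠ n in atTop, ∀ d ∈ F, ∀ x, ‖μs n x * s d - s d * μs n x‖ ≤ ε / 3 * ‖x‖ :=
      (eventually_all_finset F).2 fun d _ ↦ hμs (s d) _ (by positivity)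
    obtain ⟨n, hn⟩ := h.exists
    refine ⟨μs n, fun d hd ↦ ?_⟩
    have h1 := hn d hd u
    have h2 := norm_conj_sub (mapUnitary (μs n) u) (s d) (s d)
    rw [coe_mapUnitary] at h2
    have h3 : (μs n u) * s d * star (μs n u) - s d =
        (μs n u * s d - s d * μs n u) * ((star (mapUnitary (μs n) u) : unitary D) : D) := by
      have h4 : μs n u * star (μs n u) = 1 := Unitary.coe_mul_star_self (mapUnitary (μs n) u)
      rw [Unitary.coe_star, coe_mapUnitary, sub_mul, mul_assoc (s d), h4, mul_one]
    rw [← h2, h3, CStarRing.norm_mul_coe_unitary]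
    refine h1.trans (mul_le_of_le_one_right (by positivity) (norm_unitary_le_one u))
  obtain ⟨vn, hvn⟩ := (approxUnitarilyEquiv_id hφ μ).symm
  -- The endomorphism μ is approximately inner. The tolerance is such that the resulting conjugation
  -- error, at most twice it times ‖r d‖ ≤ M, is ε / 3.
  obtain ⟨v, hv⟩ : ∃ v : unitary D, ‖(v : D) * u * star (v : D) - μ u‖ ≤ ε / (6 * M) := by
    have h0 : 0 < ε / (6 * M) := by positivity
    obtain ⟨n, hn⟩ := ((hvn u).eventually (gt_mem_nhds h0)).exists
    exact ⟨vn n, hn.le⟩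
  -- The unitary w still conjugates r(d) nearly to s(d), and replacing μ(u) by v u v⋆ in it gives v
  -- u⋆ v⋆ u = c⁻¹, a commutator.
  let w : unitary D := (mapUnitary μ u)⁻¹ * u
  let c : unitary D := u⁻¹ * v * u⁻¹⁻¹ * v⁻¹
  have hw : (w : D) = star (μ u) * u := rfl
  have hc : ((c⁻¹ : unitary D) : D) = (v : D) * star (u : D) * star (v : D) * u := by
    have : c⁻¹ = v * u⁻¹ * v⁻¹ * u := by simp only [c]; group
    rw [this]
    rfl
  refine ⟨c, joined_one_commutator hK _ _, fun d hd ↦ ?_⟩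
  have hcw : ‖((c⁻¹ : unitary D) : D) - w‖ ≤ ε / (6 * M) := by
    have : ((c⁻¹ : unitary D) : D) - w = star ((v : D) * u * star (v : D) - μ u) * u := by
      rw [hc, hw, star_sub, star_mul, star_mul, star_star]
      noncomm_ring
    rw [this, CStarRing.norm_mul_coe_unitary, norm_star]
    exact hv
  have h1 := norm_unitary_conj_sub_le c⁻¹ w (r d)
  have h2 : 2 * ‖((c⁻¹ : unitary D) : D) - w‖ * ‖r d‖ ≤ 2 * (ε / (6 * M)) * M := by
    gcongr
    exact (norm_starHom_le r d).trans (hM d hd)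
  have h3 : 2 * (ε / (6 * M)) * M = ε / 3 := by field_simp; norm_num
  have h4 : ‖(w : D) * r d * star (w : D) - star (μ u) * s d * μ u‖ ≤ ε / 3 := by
    have : (w : D) * r d * star (w : D) - star (μ u) * s d * μ u =
        ((mapUnitary μ u)⁻¹ : unitary D) * ((u : D) * r d * star (u : D) - s d) *
          mapUnitary μ u := by
      change _ = star (μ u) * ((u : D) * r d * star (u : D) - s d) * μ u
      rw [hw, star_mul, star_star]
      noncomm_ring
    rw [this, CStarRing.norm_mul_coe_unitary, CStarRing.norm_coe_unitary_mul]
    exact hu d hd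
  have h5 := hμ d hd
  have h6 : star (c : D) * r d * (c : D) =
      ((c⁻¹ : unitary D) : D) * r d * star ((c⁻¹ : unitary D) : D) := by
    change _ = star (c : D) * r d * star (star (c : D))
    rw [star_star]
  rw [h6]
  have h7 := norm_sub_le_norm_sub_add_norm_sub (((c⁻¹ : unitary D) : D) * r d *
    star ((c⁻¹ : unitary D) : D)) ((w : D) * r d * star (w : D)) (s d)
  have h8 := norm_sub_le_norm_sub_add_norm_sub ((w : D) * r d * star (w : D))
    (star (μ u) * s d * μ u) (s d)
  linarith

end HalfFlip

/-! ### Limits of homomorphisms and one-sided approximate intertwining. -/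

section LimitHom

variable {E B : Type*} [CStarAlgebra E] [CStarAlgebra B]

/-- A sequence of unital *-homomorphisms that is pointwise Cauchy on a dense set converges
pointwise to a unital *-homomorphism. -/
theorem exists_limit_starHom (Φ : ℕ → E →⋆ₐ[ℂ] B) {S : Set E} (hS : Dense S)
    (hC : ∀ a ∈ S, CauchySeq fun n ↦ Φ n a) :
    ∃ Ψ : E →⋆ₐ[ℂ] B, ∀ a, Tendsto (fun n ↦ Φ n a) atTop (𝓝 (Ψ a)) := by
  have hC' : ∀ a, CauchySeq fun n ↦ Φ n a := by
    intro a
    rw [Metric.cauchySeq_iff']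
    intro ε hε
    obtain ⟨a', ha', hd⟩ := Metric.mem_closure_iff.1 (hS a) (ε / 4) (by positivity)
    obtain ⟨N, hN⟩ := Metric.cauchySeq_iff'.1 (hC a' ha') (ε / 4) (by positivity)
    refine ⟨N, fun n hn ↦ ?_⟩
    have h1 (k : ℕ) : dist (Φ k a) (Φ k a') ≤ dist a a' := by
      rw [dist_eq_norm, dist_eq_norm, ← map_sub]
      exact norm_starHom_le _ _
    have h2 := dist_triangle4 (Φ n a) (Φ n a') (Φ N a') (Φ N a)
    have h3 := h1 n
    have h4 := h1 N
    rw [dist_comm] at h4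
    have h5 := hN n hn
    linarith
  choose Ψ hΨ using fun a ↦ cauchySeq_tendsto_of_complete (hC' a)
  refine ⟨⟨⟨⟨⟨⟨Ψ, ?_⟩, ?_⟩, ?_, ?_⟩, ?_⟩, ?_⟩, hΨ⟩
  · exact tendsto_nhds_unique (hΨ 1) (by simp only [map_one]; exact tendsto_const_nhds)
  · exact fun a b ↦ tendsto_nhds_unique (hΨ (a * b))
      (by simpa only [map_mul] using (hΨ a).mul (hΨ b))
  · exact tendsto_nhds_unique (hΨ 0) (by simp only [map_zero]; exact tendsto_const_nhds)
  · exact fun a b ↦ tendsto_nhds_unique (hΨ (a + b))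
      (by simpa only [map_add] using (hΨ a).add (hΨ b))
  · exact fun c ↦ tendsto_nhds_unique (hΨ (algebraMap ℂ E c))
      (by simp only [AlgHomClass.commutes]; exact tendsto_const_nhds)
  · exact fun a ↦ tendsto_nhds_unique (hΨ (star a)) (by simpa only [map_star] using (hΨ a).star)

end LimitHom

section Intertwining

variable {E B N C : Type*} [CStarAlgebra E] [CStarAlgebra B] [CStarAlgebra N] [CStarAlgebra C]

open Classical in
/-- The recursion step of the one-sided approximate intertwining. -/
theorem exists_intertwining_seq [TopologicalSpace.SeparableSpace E] {ι : Type*} {L : Filter ι}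
    [L.NeBot] (f : E →⋆ₐ[ℂ] B) (q : B →⋆ₐ[ℂ] N) (V : ι → unitary B)
    (hcomm : ∀ e : E, ∀ ε : ℝ, 0 < ε → ∀ᶠ i in L, ‖(V i : B) * f e - f e * V i‖ ≤ ε)
    (happrox : ∀ b : N, ∀ ε : ℝ, 0 < ε → ∀ᶠ i in L, ∃ x : E,
      ‖star (q (V i)) * b * q (V i) - q (f x)‖ ≤ ε) (b : ℕ → N) :
    ∃ (u : ℕ → unitary B) (i : ℕ → ι) (F : ℕ → Set E), u 0 = 1 ∧
      (∀ n, u (n + 1) = u n * V (i n)) ∧ Monotone F ∧ Dense (⋃ n, F n) ∧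
      (∀ n, ∀ a ∈ F n, ‖(V (i n) : B) * f a - f a * V (i n)‖ ≤ (1 / 2 : ℝ) ^ n) ∧
      ∀ n, ∀ j ≤ n, ∃ x ∈ F (n + 1),
        ‖star (q (u (n + 1))) * b j * q (u (n + 1)) - q (f x)‖ ≤ (1 / 2 : ℝ) ^ n := by
  have step : ∀ (n : ℕ) (s : unitary B × Finset E), ∃ (i : ι) (x : ℕ → E),
      (∀ a ∈ s.2, ‖(V i : B) * f a - f a * V i‖ ≤ (1 / 2 : ℝ) ^ n) ∧
      ∀ j ≤ n, ‖star (q (V i)) * (star (q s.1) * b j * q s.1) * q (V i) - q (f (x j))‖ ≤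
        (1 / 2 : ℝ) ^ n := by
    intro n s
    have h1 : ∀ᶠ i in L, ∀ a ∈ s.2, ‖(V i : B) * f a - f a * V i‖ ≤ (1 / 2 : ℝ) ^ n :=
      (eventually_all_finset _).2 fun a _ ↦ hcomm a _ (by positivity)
    have h2 : ∀ᶠ i in L, ∀ j ∈ Finset.range (n + 1), ∃ x : E,
        ‖star (q (V i)) * (star (q s.1) * b j * q s.1) * q (V i) - q (f x)‖ ≤ (1 / 2 : ℝ) ^ n :=
      (eventually_all_finset _).2 fun j _ ↦ happrox _ _ (by positivity)
    obtain ⟨i, hi1, hi2⟩ := (h1.and h2).exists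
    have h3 : ∀ j, ∃ x : E, j ≤ n →
        ‖star (q (V i)) * (star (q s.1) * b j * q s.1) * q (V i) - q (f x)‖ ≤ (1 / 2 : ℝ) ^ n := by
      intro j
      by_cases hj : j ≤ n
      · obtain ⟨x, hx⟩ := hi2 j (Finset.mem_range.2 (by omega))
        exact ⟨x, fun _ ↦ hx⟩
      · exact ⟨0, fun h ↦ absurd h hj⟩
    choose x hx using h3
    exact ⟨i, x, hi1, hx⟩
  choose i x hi hx using step
  let e := TopologicalSpace.denseSeq E
  -- The state is the product of the unitaries so far and a finite set. The approximants x found at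
  -- stage n enter the set, so that all later unitaries nearly commute with f(x); the points e n
  -- make the union dense.
  let S : ℕ → unitary B × Finset E := fun n ↦ Nat.rec (1, ∅) (fun n s ↦
    (s.1 * V (i n s), insert (e n) (s.2 ∪ (Finset.range (n + 1)).image (x n s)))) n
  have hS (n : ℕ) : S (n + 1) = ((S n).1 * V (i n (S n)),
    insert (e n) ((S n).2 ∪ (Finset.range (n + 1)).image (x n (S n)))) := rfl
  refine ⟨fun n ↦ (S n).1, fun n ↦ i n (S n), fun n ↦ (S n).2, rfl, fun n ↦ rfl, ?_, ?_, ?_, ?_⟩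
  · refine monotone_nat_of_le_succ fun n ↦ ?_
    change ((S n).2 : Set E) ⊆ (S (n + 1)).2
    rw [hS, Finset.coe_subset]
    exact Finset.subset_union_left.trans (Finset.subset_insert _ _)
  · refine (TopologicalSpace.denseRange_denseSeq E).mono ?_
    rintro _ ⟨n, rfl⟩
    refine Set.mem_iUnion.2 ⟨n + 1, ?_⟩
    rw [hS]
    exact Finset.mem_coe.2 (Finset.mem_insert_self _ _)
  · exact fun n a ha ↦ hi n (S n) a ha
  · intro n j hj
    refine ⟨x n (S n) j, ?_, ?_⟩
    · beta_reduce
      rw [hS]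
      refine Finset.mem_coe.2 (Finset.mem_insert_of_mem (Finset.mem_union_right _ ?_))
      exact Finset.mem_image_of_mem _ (Finset.mem_range.2 (by omega))
    · have h := hx n (S n) j hj
      beta_reduce
      rw [hS]
      convert h using 3
      rw [Submonoid.coe_mul, map_mul, star_mul]
      noncomm_ring

/-- One-sided approximate intertwining: if unitaries `V i` of `B` asymptotically commute with
`f(E)` and asymptotically conjugate every element of `N` into `f(E)`, then `f` can be perturbed,
by a limit of inner automorphisms of `B` generated by the `V i`, to a map onto `N`. -/
theorem exists_bijective_of_intertwining [TopologicalSpace.SeparableSpace E]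
    [TopologicalSpace.SeparableSpace N] {ι : Type*} {L : Filter ι} [L.NeBot]
    (f : E →⋆ₐ[ℂ] B) (q : B →⋆ₐ[ℂ] N) (hinj : Function.Injective (q.comp f)) (V : ι → unitary B)
    (hcomm : ∀ e : E, ∀ ε : ℝ, 0 < ε → ∀ᶠ i in L, ‖(V i : B) * f e - f e * V i‖ ≤ ε)
    (happrox : ∀ b : N, ∀ ε : ℝ, 0 < ε → ∀ᶠ i in L, ∃ x : E,
      ‖star (q (V i)) * b * q (V i) - q (f x)‖ ≤ ε)
    (q₀ : B →⋆ₐ[ℂ] C) (hq₀ : ∀ i, q₀ (V i) = 1) :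
    ∃ Φ : E →⋆ₐ[ℂ] B, Function.Bijective (q.comp Φ) ∧ q₀.comp Φ = q₀.comp f := by
  let b := TopologicalSpace.denseSeq N
  obtain ⟨u, i, F, hu0, hu, hF, hFd, hc, ha⟩ := exists_intertwining_seq f q V hcomm happrox b
  let Ψ : ℕ → E →⋆ₐ[ℂ] B := fun n ↦ (conjHom (u n)).comp f
  -- Passing from Ψ n to Ψ (n + 1) moves a by exactly the norm of the commutator of V (i n) with
  -- f(a), at most 2⁻ⁿ once a ∈ F n.
  have hstep : ∀ m, ∀ a ∈ F m, ∀ k,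
      dist (Ψ (k + m) a) (Ψ (k + 1 + m) a) ≤ (1 / 2 : ℝ) ^ m * (1 / 2) ^ k := by
    intro m a ham k
    rw [← pow_add, add_right_comm k 1 m, add_comm m k, dist_comm, dist_eq_norm]
    have h1 := hc (k + m) a (hF (Nat.le_add_left m k) ham)
    refine le_trans (le_of_eq ?_) h1
    set n := k + m
    have h2 : (V (i n) : B) * star (V (i n) : B) = 1 := Unitary.coe_mul_star_self _
    have h3 : Ψ (n + 1) a - Ψ n a = (u n : B) * (((V (i n) : B) * f a - f a * V (i n)) *
        ((star (V (i n)) : unitary B) : B)) * star (u n : B) := by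
      have h4 : f a * (V (i n) : B) * star (V (i n) : B) = f a := by rw [mul_assoc, h2, mul_one]
      simp only [Ψ, StarAlgHom.comp_apply, conjHom_apply, hu, Submonoid.coe_mul, star_mul,
        Unitary.coe_star, sub_mul, h4, mul_sub, mul_assoc]
    rw [h3, norm_conj, CStarRing.norm_mul_coe_unitary]
  obtain ⟨Φ, hΦ⟩ := exists_limit_starHom Ψ hFd (fun a ha' ↦ by
    obtain ⟨m, hm⟩ := Set.mem_iUnion.1 ha'
    exact (cauchySeq_shift m).1 (cauchySeq_of_le_geometric (f := fun k ↦ Ψ (k + m) a) (1 / 2)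
      ((1 / 2 : ℝ) ^ m) (by norm_num) (hstep m a hm)))
  have hdist : ∀ m, ∀ a ∈ F m, dist (Ψ m a) (Φ a) ≤ 2 * (1 / 2 : ℝ) ^ m := by
    intro m a ham
    have h := dist_le_of_le_geometric_of_tendsto₀ (f := fun k ↦ Ψ (k + m) a) (1 / 2)
      ((1 / 2 : ℝ) ^ m) (by norm_num) (hstep m a ham) ((tendsto_add_atTop_iff_nat m).2 (hΦ a))
    rw [zero_add] at h
    exact h.trans (le_of_eq (by ring))
  -- Each q ∘ Ψ n is a unitary conjugate of the injective, hence isometric, q ∘ f.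
  have hnorm : ∀ a, ‖q.comp Φ a‖ = ‖a‖ := by
    intro a
    have h1 : Tendsto (fun n ↦ ‖q (Ψ n a)‖) atTop (𝓝 ‖q (Φ a)‖) :=
      (((continuous_starHom q).tendsto _).comp (hΦ a)).norm
    have h2 : ∀ n, ‖q (Ψ n a)‖ = ‖a‖ := by
      intro n
      have h3 := norm_conj (mapUnitary q (u n)) (q (f a))
      simp only [Ψ, StarAlgHom.comp_apply, conjHom_apply, map_mul, map_star]
      exact h3.trans (NonUnitalStarAlgHom.norm_map (q.comp f) hinj a)
    simp only [h2] at h1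
    exact tendsto_nhds_unique tendsto_const_nhds h1 |>.symm
  have hinj' : Function.Injective (q.comp Φ) :=
    (injective_iff_map_eq_zero _).2 fun a h ↦ norm_eq_zero.1 (by rw [← hnorm a, h, norm_zero])
  refine ⟨Φ, ⟨hinj', ?_⟩, ?_⟩
  · have hcl : IsClosed (Set.range (q.comp Φ)) :=
      (NonUnitalStarAlgHom.isometry (q.comp Φ) hinj').isClosedEmbedding.isClosed_range
    -- The range is closed, so approximation suffices: b j is within 2⁻ⁿ of q(Ψ (n + 1) x), which is
    -- within 2 · 2⁻⁽ⁿ⁺¹⁾ of q(Φ x).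
    have hb : Set.range b ⊆ Set.range (q.comp Φ) := by
      rintro _ ⟨j, rfl⟩
      rw [← hcl.closure_eq]
      refine Metric.mem_closure_iff.2 fun ε hε ↦ ?_
      obtain ⟨n, hjn, hn⟩ : ∃ n, j ≤ n ∧ 2 * (1 / 2 : ℝ) ^ n < ε := by
        have h1 : Tendsto (fun n : ℕ ↦ 2 * (1 / 2 : ℝ) ^ n) atTop (𝓝 (2 * 0)) :=
          (tendsto_pow_atTop_nhds_zero_of_lt_one (by norm_num) (by norm_num)).const_mul 2
        rw [mul_zero] at h1
        exact ((eventually_ge_atTop j).and (h1.eventually (gt_mem_nhds hε))).exists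
      obtain ⟨x, hxF, hx⟩ := ha n j hjn
      refine ⟨_, ⟨x, rfl⟩, ?_⟩
      have h2 := hdist (n + 1) x hxF
      have h3 : dist (q (Ψ (n + 1) x)) (q (Φ x)) ≤ 2 * (1 / 2 : ℝ) ^ (n + 1) := by
        refine le_trans ?_ h2
        rw [dist_eq_norm, dist_eq_norm, ← map_sub]
        exact norm_starHom_le _ _
      have h4 : dist (b j) (q (Ψ (n + 1) x)) ≤ (1 / 2 : ℝ) ^ n := by
        rw [dist_comm, dist_eq_norm]
        have h5 := norm_conj_sub (mapUnitary q (u (n + 1))) (q (f x)) (b j)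
        simp only [Ψ, StarAlgHom.comp_apply, conjHom_apply, map_mul, map_star]
        exact h5.le.trans hx
      have h6 := dist_triangle (b j) (q (Ψ (n + 1) x)) (q (Φ x))
      rw [pow_succ] at h3
      change dist (b j) (q (Φ x)) < ε
      linarith
    have huniv : Set.range (q.comp Φ) = Set.univ := by
      refine Set.eq_univ_of_univ_subset ?_
      rw [← (TopologicalSpace.denseRange_denseSeq N).closure_eq]
      exact closure_minimal hb hcl
    exact Set.range_eq_univ.1 huniv
  · have hq0u : ∀ n, q₀ (u n) = 1 := by
      intro n
      induction n with
      | zero => rw [hu0]; exact map_one q₀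
      | succ n ih => rw [hu, Submonoid.coe_mul, map_mul, ih, hq₀, one_mul]
    ext a
    have h1 : Tendsto (fun n ↦ q₀ (Ψ n a)) atTop (𝓝 (q₀ (Φ a))) :=
      ((continuous_starHom q₀).tendsto _).comp (hΦ a)
    have h2 : ∀ n, q₀ (Ψ n a) = q₀ (f a) := by
      intro n
      simp only [Ψ, StarAlgHom.comp_apply, conjHom_apply, map_mul, map_star, hq0u, star_one,
        one_mul, mul_one]
    simp only [h2] at h1
    exact tendsto_nhds_unique h1 tendsto_const_nhds

end Intertwining

/-! ### Path algebras. -/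

section Paths

variable {A B : Type*} [CStarAlgebra A] [CStarAlgebra B]

/-- Evaluation of a path at `t`. -/
def evalHom (A : Type*) [CStarAlgebra A] (t : unitInterval) : C(unitInterval, A) →⋆ₐ[ℂ] A where
  toFun f := f t
  map_one' := rfl
  map_mul' _ _ := rfl
  map_zero' := rfl
  map_add' _ _ := rfl
  commutes' _ := rfl
  map_star' _ := rfl

/-- The inclusion of the constant paths. -/
def constHom (A : Type*) [CStarAlgebra A] : A →⋆ₐ[ℂ] C(unitInterval, A) where
  toFun a := .const _ a
  map_one' := rfl
  map_mul' _ _ := rfl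
  map_zero' := rfl
  map_add' _ _ := rfl
  commutes' _ := rfl
  map_star' _ := rfl

/-- The *-homomorphism of path algebras induced by a *-homomorphism. -/
def pathHom (f : A →⋆ₐ[ℂ] B) : C(unitInterval, A) →⋆ₐ[ℂ] C(unitInterval, B) :=
  ContinuousMap.compStarAlgHom unitInterval f (continuous_starHom f)

theorem exists_unitary_path {c : unitary A} (hc : Joined 1 c) :
    ∃ W : unitary C(unitInterval, A), W.1 0 = 1 ∧ W.1 1 = c := by
  obtain ⟨p⟩ := hc
  refine ⟨⟨⟨fun t ↦ (p t : A), by fun_prop⟩, ?_⟩, ?_, ?_⟩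
  · rw [Unitary.mem_iff]
    exact ⟨ContinuousMap.ext fun t ↦ Unitary.coe_star_mul_self (p t),
      ContinuousMap.ext fun t ↦ Unitary.coe_mul_star_self (p t)⟩
  · exact congrArg Subtype.val p.source
  · exact congrArg Subtype.val p.target

theorem homotopic_of_path (Φ : A →⋆ₐ[ℂ] C(unitInterval, B)) :
    Homotopic ((evalHom B 0).comp Φ) ((evalHom B 1).comp Φ) :=
  ⟨fun t ↦ (evalHom B t).comp Φ, fun d ↦ (Φ d).continuous, rfl, rfl⟩

end Paths

namespace MinTensor

variable {A B : Type*} [CStarAlgebra A] [CStarAlgebra B]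

theorem separableSpace [TopologicalSpace.SeparableSpace A] [TopologicalSpace.SeparableSpace B] :
    TopologicalSpace.SeparableSpace (MinTensor A B) := by
  have hc : Continuous fun p : A × B ↦ tmul p.1 p.2 := by
    simp only [← inclLeft_mul_inclRight]
    exact ((continuous_starHom _).comp continuous_fst).mul
      ((continuous_starHom _).comp continuous_snd)
  exact dense_span_tmul.isSeparable_iff.1 (TopologicalSpace.isSeparable_range hc).span

end MinTensor

/-! ### Absorption of D, up to homotopy. -/

section Absorption

variable {D E : Type*} [CStarAlgebra D] [CStarAlgebra E]

open MinTensor (inclLeft inclRight tmul)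

/-- The C-leg commutes with e ⊗ 1, so on elementary tensors only the commutator of ψ n(a) with e
remains. The commutator is 2‖e‖-Lipschitz in y uniformly in n, which gives closedness. -/
theorem AsympCentral.eventually_commutator_le {C : Type*} [CStarAlgebra C]
    {ψ : ℕ → D →⋆ₐ[ℂ] E} (hψ : AsympCentral ψ) (e : E) (y : MinTensor D C) :
    ∀ ε : ℝ, 0 < ε → ∀ᶠ n in atTop,
      ‖MinTensor.map (ψ n) (StarAlgHom.id ℂ C) y * inclLeft E C e -
        inclLeft E C e * MinTensor.map (ψ n) (StarAlgHom.id ℂ C) y‖ ≤ ε := by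
  revert y
  have hsmall (z w : MinTensor D C) (n : ℕ) :
      ‖MinTensor.map (ψ n) (StarAlgHom.id ℂ C) z * inclLeft E C e -
        inclLeft E C e * MinTensor.map (ψ n) (StarAlgHom.id ℂ C) z‖ ≤
      ‖MinTensor.map (ψ n) (StarAlgHom.id ℂ C) w * inclLeft E C e -
        inclLeft E C e * MinTensor.map (ψ n) (StarAlgHom.id ℂ C) w‖ + 2 * ‖e‖ * ‖z - w‖ := by
    set f := MinTensor.map (ψ n) (StarAlgHom.id ℂ C)
    set l := inclLeft E C e
    have h1 : f z * l - l * f z = (f w * l - l * f w) - (l * f (z - w) - f (z - w) * l) := by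
      rw [map_sub]
      noncomm_ring
    rw [h1]
    refine (norm_sub_le _ _).trans (add_le_add le_rfl ?_)
    have h2 := norm_commutator_le l (f (z - w)) 0 (by simp)
    rw [sub_zero] at h2
    refine h2.trans ?_
    have h3 : ‖l‖ ≤ ‖e‖ := norm_starHom_le _ _
    have h4 : ‖f (z - w)‖ ≤ ‖z - w‖ := norm_starHom_le _ _
    gcongr
  refine MinTensor.induction_closed ?_ (fun a b ε hε ↦ ?_) fun x y hx hy ε hε ↦ ?_
  · refine isClosed_of_closure_subset fun y hy ε hε ↦ ?_
    obtain ⟨z, hz, hd⟩ := Metric.mem_closure_iff.1 hy (ε / (4 * (‖e‖ + 1))) (by positivity)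
    filter_upwards [hz (ε / 2) (by positivity)] with n hn
    refine (hsmall y z n).trans ?_
    rw [dist_eq_norm] at hd
    have h1 : 2 * ‖e‖ * ‖y - z‖ ≤ 2 * (‖e‖ + 1) * (ε / (4 * (‖e‖ + 1))) := by
      gcongr
      linarith
    have h2 : 2 * (‖e‖ + 1) * (ε / (4 * (‖e‖ + 1))) = ε / 2 := by
      field_simp
      norm_num
    linarith
  · filter_upwards [hψ e (ε / (‖a‖ * ‖b‖ + 1)) (by positivity)] with n hn
    rw [MinTensor.map_tmul, MinTensor.inclLeft_apply, MinTensor.tmul_mul, MinTensor.tmul_mul,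
      mul_one, one_mul, ← MinTensor.sub_tmul]
    refine (MinTensor.norm_tmul_le _ _).trans ?_
    calc ‖ψ n a * e - e * ψ n a‖ * ‖b‖ ≤ (ε / (‖a‖ * ‖b‖ + 1) * ‖a‖) * ‖b‖ := by
          gcongr
          exact hn a
      _ = ε * ((‖a‖ * ‖b‖) / (‖a‖ * ‖b‖ + 1)) := by ring
      _ ≤ ε * 1 := by
        gcongr
        exact (div_le_one (by positivity)).2 (by linarith)
      _ = ε := mul_one _
  · filter_upwards [hx (ε / 2) (by positivity), hy (ε / 2) (by positivity)] with n h1 h2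
    set f := MinTensor.map (ψ n) (StarAlgHom.id ℂ C)
    set l := inclLeft E C e
    have h3 : f (x + y) * l - l * f (x + y) = (f x * l - l * f x) + (f y * l - l * f y) := by
      rw [map_add]
      noncomm_ring
    rw [h3]
    exact (norm_add_le _ _).trans (by linarith)

/-- Compactness of [0,1] and the uniform Lipschitz estimate reduce uniformity in t to finitely many
points. -/
theorem AsympCentral.eventually_path_commutator_le {C : Type*} [CStarAlgebra C]
    {ψ : ℕ → D →⋆ₐ[ℂ] E} (hψ : AsympCentral ψ) (e : E) (Y : C(unitInterval, MinTensor D C))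
    {ε : ℝ} (hε : 0 < ε) : ∀ᶠ n in atTop, ∀ t,
      ‖MinTensor.map (ψ n) (StarAlgHom.id ℂ C) (Y t) * inclLeft E C e -
        inclLeft E C e * MinTensor.map (ψ n) (StarAlgHom.id ℂ C) (Y t)‖ ≤ ε := by
  set δ := ε / (4 * (‖e‖ + 1)) with hδ
  have hδ0 : 0 < δ := by positivity
  obtain ⟨T, -, hT⟩ := isCompact_univ.elim_nhds_subcover
    (fun s : unitInterval ↦ {t | dist (Y t) (Y s) < δ})
    (fun s _ ↦ Y.continuous.continuousAt (Metric.ball_mem_nhds (Y s) hδ0))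
  have h := (eventually_all_finset T).2 fun s (_ : s ∈ T) ↦
    hψ.eventually_commutator_le e (Y s) (ε / 2) (by positivity)
  filter_upwards [h] with n hn t
  obtain ⟨s, hs, hts⟩ := Set.mem_iUnion₂.1 (hT (Set.mem_univ t))
  have h0 := hn s hs
  set f := MinTensor.map (ψ n) (StarAlgHom.id ℂ C)
  set l := inclLeft E C e
  have h1 : f (Y t) * l - l * f (Y t) =
      (f (Y s) * l - l * f (Y s)) - (l * f (Y t - Y s) - f (Y t - Y s) * l) := by
    rw [map_sub]
    noncomm_ring
  rw [h1]
  have h2 := norm_commutator_le l (f (Y t - Y s)) 0 (by simp)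
  have hd : ‖Y t - Y s‖ < δ := by rw [← dist_eq_norm]; exact hts
  have h3 : ‖l‖ ≤ ‖e‖ := norm_starHom_le _ _
  have h4 : ‖f (Y t - Y s)‖ ≤ ‖Y t - Y s‖ := norm_starHom_le _ _
  rw [sub_zero] at h2
  have h5 : 2 * ‖l‖ * ‖f (Y t - Y s)‖ ≤ 2 * (‖e‖ + 1) * δ := by
    gcongr
    · linarith
    · linarith
  have h6 : 2 * (‖e‖ + 1) * δ = ε / 2 := by
    rw [hδ]
    field_simp
    norm_num
  refine (norm_sub_le _ _).trans ?_
  linarith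

end Absorption

theorem neBot_curry {α β : Type*} (l : Filter α) (m : Filter β) [l.NeBot] [m.NeBot] :
    (l.curry m).NeBot := by
  by_contra hb
  have h : ∀ᶠ _ in l.curry m, False := by
    rw [not_neBot.1 hb]
    exact eventually_bot
  obtain ⟨_, h⟩ := (eventually_curry_iff.1 h).exists
  exact h.exists.elim fun _ h ↦ h

section Absorption

variable {D : Type u} {E : Type v} [CStarAlgebra D] [CStarAlgebra E]

open MinTensor (inclLeft inclRight tmul)

/-- If `E` admits an asymptotically central sequence of copies of `D`, the inclusion `E → E ⊗ D` is
homotopic to an isomorphism. -/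
theorem exists_iso_homotopic_inclLeft [TopologicalSpace.SeparableSpace D]
    [TopologicalSpace.SeparableSpace E] (hK : IsKOneInjective D) {φ : D ≃⋆ₐ[ℂ] MinTensor D D}
    (hφ : ApproxUnitarilyEquiv (φ : D →⋆ₐ[ℂ] MinTensor D D) (inclLeft D D))
    (hinj : Function.Injective (inclLeft E D)) {ψ : ℕ → D →⋆ₐ[ℂ] E} (hψ : AsympCentral ψ) :
    ∃ χ : E ≃⋆ₐ[ℂ] MinTensor E D, Homotopic (inclLeft E D) (χ : E →⋆ₐ[ℂ] MinTensor E D) := by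
  have : TopologicalSpace.SeparableSpace (MinTensor E D) := MinTensor.separableSpace
  choose c hc1 hc2 using fun k : Finset D × ℕ ↦ exists_joined_halfFlip hK hφ k.1
    (ε := 1 / ((k.2 : ℝ) + 1)) (by positivity)
  choose W hW0 hW1 using fun k ↦ exists_unitary_path (hc1 k)
  -- This transports the half-flip to E ⊗ D: it sends the left leg of d to ψ n(d) ⊗ 1 and the right
  -- leg to 1 ⊗ d.
  let g (n : ℕ) : D →⋆ₐ[ℂ] MinTensor E D :=
    (MinTensor.map (ψ n) (StarAlgHom.id ℂ D)).comp (φ : D →⋆ₐ[ℂ] MinTensor D D)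
  let V : (Finset D × ℕ) × ℕ → unitary C(unitInterval, MinTensor E D) :=
    fun i ↦ mapUnitary (pathHom (g i.2)) (W i.1)
  have hgl (n : ℕ) (d : D) : g n (φ.symm (inclLeft D D d)) = inclLeft E D (ψ n d) := by
    change MinTensor.map (ψ n) (StarAlgHom.id ℂ D) (φ (φ.symm (inclLeft D D d))) = _
    rw [φ.apply_symm_apply]
    exact MinTensor.map_tmul _ _ _ _
  have hgr (n : ℕ) (d : D) : g n (φ.symm (inclRight D D d)) = inclRight E D d := by
    change MinTensor.map (ψ n) (StarAlgHom.id ℂ D) (φ (φ.symm (inclRight D D d))) = _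
    rw [φ.apply_symm_apply, MinTensor.inclRight_apply, MinTensor.map_tmul, map_one]
    rfl
  have hcomm_path : ∀ (k : Finset D × ℕ) (e : E) (ε : ℝ), 0 < ε → ∀ᶠ n in atTop, ∀ t,
      ‖g n ((W k).1 t) * inclLeft E D e - inclLeft E D e * g n ((W k).1 t)‖ ≤ ε :=
    fun k e ε hε ↦ hψ.eventually_path_commutator_le e
      (pathHom (φ : D →⋆ₐ[ℂ] MinTensor D D) (W k).1) hε
  classical
  -- The iterated filter lets n be chosen after k: how central ψ n must be depends on the whole path
  -- W k.
  have := neBot_curry (atTop : Filter (Finset D × ℕ)) (atTop : Filter ℕ)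
  obtain ⟨Φ, hΦ1, hΦ0⟩ := exists_bijective_of_intertwining
    (L := (atTop : Filter (Finset D × ℕ)).curry (atTop : Filter ℕ))
    ((constHom (MinTensor E D)).comp (inclLeft E D)) (evalHom (MinTensor E D) 1) hinj V
    (fun e ε hε ↦ by
      refine eventually_curry_iff.2 (Eventually.of_forall fun k ↦ ?_)
      filter_upwards [hcomm_path k e ε hε] with n hn
      exact (ContinuousMap.norm_le _ hε.le).2 hn)
    (by
      refine MinTensor.induction_closed ?_ (fun a d ε hε ↦ ?_) fun x y hx hy ε hε ↦ ?_
      · refine isClosed_of_closure_subset fun b hb ε hε ↦ ?_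
        obtain ⟨z, hz, hd⟩ := Metric.mem_closure_iff.1 hb (ε / 2) (by positivity)
        filter_upwards [hz (ε / 2) (by positivity)] with i hi
        obtain ⟨x, hx⟩ := hi
        refine ⟨x, ?_⟩
        set v := evalHom (MinTensor E D) 1 (V i)
        have h1 : ‖star v * b * v - star v * z * v‖ = ‖b - z‖ := by
          rw [← sub_mul, ← mul_sub]
          exact (CStarRing.norm_mul_coe_unitary _ (mapUnitary (evalHom _ 1) (V i))).trans
            (CStarRing.norm_coe_unitary_mul (star (mapUnitary (evalHom _ 1) (V i))) _)
        rw [dist_eq_norm, ← h1] at hd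
        exact (norm_sub_le_norm_sub_add_norm_sub _ (star v * z * v) _).trans (by linarith)
      · refine eventually_curry_iff.2 ?_
        have hk0 : Tendsto (fun k : Finset D × ℕ ↦ 1 / ((k.2 : ℝ) + 1)) atTop (𝓝 0) := by
          refine tendsto_one_div_add_atTop_nhds_zero_nat.comp ?_
          rw [← prod_atTop_atTop_eq]
          exact tendsto_snd
        have hpos : 0 < ε / (2 * (‖a‖ + 1)) := by positivity
        filter_upwards [hk0.eventually (gt_mem_nhds hpos),
          eventually_ge_atTop (({d}, 0) : Finset D × ℕ)] with k hk1 hk2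
        have hdk : d ∈ k.1 := hk2.1 (Finset.mem_singleton_self d)
        filter_upwards [hcomm_path k a (ε / (2 * (‖d‖ + 1))) (by positivity)] with n hn
        -- The unitary w nearly commutes with a ⊗ 1 and moves 1 ⊗ d nearly to ψ n(d) ⊗ 1, so a ⊗ d
        -- lands near E ⊗ 1.
        refine ⟨a * ψ n d, ?_⟩
        let w : unitary (MinTensor E D) := mapUnitary (g n) (c k)
        have hv : evalHom (MinTensor E D) 1 (V (k, n)) = w := congrArg (g n) (hW1 k)
        have hla := hn 1
        rw [hW1 k] at hla
        have hr : ‖star (w : MinTensor E D) * inclRight E D d * w - inclLeft E D (ψ n d)‖ ≤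
            1 / ((k.2 : ℝ) + 1) := by
          have h1 := hc2 k d hdk
          refine le_trans (le_of_eq ?_) ((norm_starHom_le (g n) _).trans h1)
          rw [map_sub, map_mul, map_mul, map_star, hgl, hgr]
          rfl
        have hl : ‖star (w : MinTensor E D) * inclLeft E D a -
            inclLeft E D a * star (w : MinTensor E D)‖ ≤ ε / (2 * (‖d‖ + 1)) := by
          have h1 : star (w : MinTensor E D) * w = 1 := Unitary.coe_star_mul_self w
          have h2 : (w : MinTensor E D) * star (w : MinTensor E D) = 1 :=
            Unitary.coe_mul_star_self w
          have h3 : star (w : MinTensor E D) * inclLeft E D a -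
              inclLeft E D a * star (w : MinTensor E D) =
              -(((star w : unitary (MinTensor E D)) : MinTensor E D) *
                ((w : MinTensor E D) * inclLeft E D a - inclLeft E D a * w) *
                ((star w : unitary (MinTensor E D)) : MinTensor E D)) := by
            rw [Unitary.coe_star, mul_sub, sub_mul, ← mul_assoc, h1, one_mul,
              mul_assoc (star (w : MinTensor E D)), mul_assoc (inclLeft E D a), h2, mul_one,
              neg_sub]
          rw [h3, norm_neg, CStarRing.norm_mul_coe_unitary, CStarRing.norm_coe_unitary_mul]
          exact hla
        change ‖star (evalHom (MinTensor E D) 1 (V (k, n))) * tmul a d *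
          evalHom (MinTensor E D) 1 (V (k, n)) - inclLeft E D (a * ψ n d)‖ ≤ ε
        rw [hv, ← MinTensor.inclLeft_mul_inclRight, map_mul]
        have hsplit : star (w : MinTensor E D) * (inclLeft E D a * inclRight E D d) * w -
            inclLeft E D a * inclLeft E D (ψ n d) =
            (star (w : MinTensor E D) * inclLeft E D a -
              inclLeft E D a * star (w : MinTensor E D)) *
              inclRight E D d * w + inclLeft E D a *
                (star (w : MinTensor E D) * inclRight E D d * w - inclLeft E D (ψ n d)) := by
          noncomm_ring
        rw [hsplit]
        have e1 : ‖(star (w : MinTensor E D) * inclLeft E D a -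
              inclLeft E D a * star (w : MinTensor E D)) *
            inclRight E D d * w‖ ≤ ε / (2 * (‖d‖ + 1)) * (‖d‖ + 1) := by
          rw [CStarRing.norm_mul_coe_unitary]
          have h4 : ‖inclRight E D d‖ ≤ ‖d‖ + 1 := (norm_starHom_le _ _).trans (by linarith)
          refine (norm_mul_le _ _).trans ?_
          gcongr
        have e2 : ‖inclLeft E D a *
            (star (w : MinTensor E D) * inclRight E D d * w - inclLeft E D (ψ n d))‖ ≤
            (‖a‖ + 1) * (ε / (2 * (‖a‖ + 1))) := by
          have h4 : ‖inclLeft E D a‖ ≤ ‖a‖ + 1 := (norm_starHom_le _ _).trans (by linarith)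
          have h5 := hr.trans hk1.le
          refine (norm_mul_le _ _).trans ?_
          gcongr
        have e3 : ε / (2 * (‖d‖ + 1)) * (‖d‖ + 1) = ε / 2 := by field_simp
        have e4 : (‖a‖ + 1) * (ε / (2 * (‖a‖ + 1))) = ε / 2 := by field_simp
        refine (norm_add_le _ _).trans ?_
        linarith
      · filter_upwards [hx (ε / 2) (by positivity), hy (ε / 2) (by positivity)] with i h1 h2
        obtain ⟨x', hx'⟩ := h1
        obtain ⟨y', hy'⟩ := h2
        refine ⟨x' + y', ?_⟩
        simp only [map_add, mul_add, add_mul]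
        rw [add_sub_add_comm]
        exact (norm_add_le _ _).trans (by linarith))
    -- Every V i is 1 at time 0, so Φ still starts at the inclusion, while at time 1 it is
    -- bijective.
    (evalHom (MinTensor E D) 0) (fun i ↦ (congrArg (g i.2) (hW0 i.1)).trans (map_one _))
  refine ⟨StarAlgEquiv.ofBijective ((evalHom (MinTensor E D) 1).comp Φ) hΦ1, ?_⟩
  have h := homotopic_of_path Φ
  rw [hΦ0] at h
  exact h

end Absorption

/-! ### Homotopy of the two legs. -/

section Homotopy

variable {A B C : Type*} [CStarAlgebra A] [CStarAlgebra B] [CStarAlgebra C]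

theorem Homotopic.refl (σ : A →⋆ₐ[ℂ] B) : Homotopic σ σ := (homotopySetoid A B).refl σ

theorem Homotopic.symm {σ γ : A →⋆ₐ[ℂ] B} (h : Homotopic σ γ) : Homotopic γ σ :=
  (homotopySetoid A B).symm h

theorem Homotopic.trans {σ γ τ : A →⋆ₐ[ℂ] B} (h : Homotopic σ γ) (h' : Homotopic γ τ) :
    Homotopic σ τ := (homotopySetoid A B).trans h h'

theorem Homotopic.comp_left {σ γ : A →⋆ₐ[ℂ] B} (f : B →⋆ₐ[ℂ] C) (h : Homotopic σ γ) :
    Homotopic (f.comp σ) (f.comp γ) := by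
  obtain ⟨H, hc, rfl, rfl⟩ := h
  exact ⟨fun t ↦ f.comp (H t), fun d ↦ (continuous_starHom f).comp (hc d), rfl, rfl⟩

theorem Homotopic.comp_right {σ γ : A →⋆ₐ[ℂ] B} (f : C →⋆ₐ[ℂ] A) (h : Homotopic σ γ) :
    Homotopic (σ.comp f) (γ.comp f) := by
  obtain ⟨H, hc, rfl, rfl⟩ := h
  exact ⟨fun t ↦ (H t).comp f, fun d ↦ hc (f d), rfl, rfl⟩

theorem symm_comp_coe (χ : A ≃⋆ₐ[ℂ] B) :
    (χ.symm : B →⋆ₐ[ℂ] A).comp (χ : A →⋆ₐ[ℂ] B) = StarAlgHom.id ℂ A :=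
  StarAlgHom.ext χ.symm_apply_apply

theorem coe_comp_symm (χ : A ≃⋆ₐ[ℂ] B) :
    (χ : A →⋆ₐ[ℂ] B).comp (χ.symm : B →⋆ₐ[ℂ] A) = StarAlgHom.id ℂ B :=
  StarAlgHom.ext χ.apply_symm_apply

end Homotopy

open MinTensor (inclLeft inclRight tmul)

variable {D : Type u} [CStarAlgebra D]

/-- The two embeddings of a strongly self-absorbing, `K₁`-injective algebra into its tensor square
are homotopic. -/
theorem homotopic_inclLeft_inclRight [TopologicalSpace.SeparableSpace D]
    (hK : IsKOneInjective D) {φ : D ≃⋆ₐ[ℂ] MinTensor D D}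
    (hφ : ApproxUnitarilyEquiv (φ : D →⋆ₐ[ℂ] MinTensor D D) (inclLeft D D)) :
    Homotopic (inclLeft D D) (inclRight D D) := by
  obtain ⟨μ, hμ⟩ := exists_asympCentral hφ
  obtain ⟨χ, hχ⟩ := exists_iso_homotopic_inclLeft hK hφ
    (inclLeft_injective_of_approxUnitarilyEquiv hφ) hμ
  have hs : Homotopic ((χ.symm : MinTensor D D →⋆ₐ[ℂ] D).comp (inclLeft D D))
      (StarAlgHom.id ℂ D) := by
    have := hχ.comp_left (χ.symm : MinTensor D D →⋆ₐ[ℂ] D)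
    rwa [symm_comp_coe] at this
  -- Eckmann–Hilton a second time, for homotopy and for χ in place of φ: all endomorphisms of D are
  -- homotopic to the identity.
  have hall := rel_id_of_rel_symm_inclLeft χ ⟨.refl, .symm, .trans⟩
    (fun f _ _ ↦ Homotopic.comp_left f) (fun f _ _ ↦ Homotopic.comp_right f) hs
  have h := (hs.trans (hall ((χ.symm : MinTensor D D →⋆ₐ[ℂ] D).comp
    (inclRight D D))).symm).comp_left (χ : D →⋆ₐ[ℂ] MinTensor D D)
  rwa [← StarAlgHom.comp_assoc, ← StarAlgHom.comp_assoc, coe_comp_symm, StarAlgHom.id_comp,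
    StarAlgHom.id_comp] at h

/-- Since χ is homotopic to e ↦ e ⊗ 1, σ ∼ χ⁻¹(σ(·) ⊗ 1). Applying σ ⊗ id to d ⊗ 1 ∼ 1 ⊗ d then
yields an endpoint independent of σ. -/
theorem homotopic_symm_comp_inclRight {E : Type v} [CStarAlgebra E]
    (hlr : Homotopic (inclLeft D D) (inclRight D D)) {χ : E ≃⋆ₐ[ℂ] MinTensor E D}
    (hχ : Homotopic (inclLeft E D) (χ : E →⋆ₐ[ℂ] MinTensor E D)) (σ : D →⋆ₐ[ℂ] E) :
    Homotopic σ ((χ.symm : MinTensor E D →⋆ₐ[ℂ] E).comp (inclRight E D)) := by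
  have h1 := (hχ.comp_right σ).comp_left (χ.symm : MinTensor E D →⋆ₐ[ℂ] E)
  rw [← StarAlgHom.comp_assoc _ (χ : E →⋆ₐ[ℂ] MinTensor E D), symm_comp_coe,
    StarAlgHom.id_comp] at h1
  have h2 := hlr.comp_left (MinTensor.map σ (StarAlgHom.id ℂ D))
  rw [MinTensor.map_comp_inclLeft, MinTensor.map_comp_inclRight, StarAlgHom.comp_id] at h2
  exact h1.symm.trans (h2.comp_left _)

/-! ### Reduction to a separable subalgebra of A ⊗ D. -/

section Separable

variable {R : Type v} [CStarAlgebra R]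

theorem isSeparable_closedAdjoin {S : Set R} (hS : S.Countable) :
    TopologicalSpace.IsSeparable (closedAdjoin S : Set R) := by
  have h1 : (Submonoid.closure (S ∪ star S) : Set R).Countable := by
    have hU : (S ∪ star S).Countable := hS.union (by
      rw [← Set.image_star]
      exact hS.image _)
    have : Countable ↥(S ∪ star S) := hU
    refine (Set.countable_range fun l : List ↥(S ∪ star S) ↦ (l.map Subtype.val).prod).mono ?_
    intro x hx
    obtain ⟨l, hl, rfl⟩ := Submonoid.exists_list_of_mem_closure hx
    lift l to List ↥(S ∪ star S) using hl
    exact ⟨l, rfl⟩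
  have h2 : (StarAlgebra.adjoin ℂ S : Set R) =
      (Submodule.span ℂ (Submonoid.closure (S ∪ star S) : Set R) : Set R) :=
    congrArg (fun p : Submodule ℂ R ↦ (p : Set R)) (StarAlgebra.adjoin_eq_span S)
  have h3 : TopologicalSpace.IsSeparable (StarAlgebra.adjoin ℂ S : Set R) := by
    rw [h2]
    exact h1.isSeparable.span
  exact h3.closure

end Separable

section SubalgebraOfTensor

variable {A : Type v} [CStarAlgebra A]

/-- If e ≠ 0, some block of A ⊗ D yields a vector state ω of E with ω(e⋆e) ≠ 0. The same block
supplies a state of D, and the product of the two does not vanish at e⋆e ⊗ 1. -/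
theorem inclLeft_injective_of_embedding {E : Type*} [CStarAlgebra E] (j : E →⋆ₐ[ℂ] MinTensor A D)
    (hj : Function.Injective j) : Function.Injective (inclLeft E D) := by
  refine (injective_iff_map_eq_zero _).2 fun e he ↦ ?_
  by_contra hne
  obtain ⟨p, hp⟩ := MinTensor.exists_blockRep_ne_zero (x := j e)
    (fun h ↦ hne ((map_eq_zero_iff j hj).1 h))
  set T := MinTensor.blockRep p (j e) with hT
  obtain ⟨ξ, hξ⟩ : ∃ ξ, T ξ ≠ 0 := by
    by_contra! h
    exact hp (ContinuousLinearMap.ext h)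
  have hξ0 : ξ ≠ 0 := fun h ↦ hξ (by rw [h, map_zero])
  set ζ := (‖ξ‖ : ℂ)⁻¹ • ξ with hζ
  have hζ1 : ‖ζ‖ = 1 := by
    rw [hζ, norm_smul]
    simp [hξ0]
  have hTζ : T ζ ≠ 0 := by
    rw [hζ, map_smul]
    exact smul_ne_zero (inv_ne_zero (by simpa using hξ0)) hξ
  let ω : State E := vectorState ((MinTensor.blockRep p).comp j) ζ hζ1
  have h1 : ω.toLin (star e * e) = inner ℂ (T ζ) (T ζ) := by
    rw [vectorState_toLin, map_mul, map_star, StarAlgHom.comp_apply, ← hT,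
      ContinuousLinearMap.star_eq_adjoint, mul_apply_eq_comp,
      ContinuousLinearMap.adjoint_inner_right]
  have h2 := MinTensor.inner_cyc_tmul ((ω, p.2) : State E × State D) (star e * e) 1
  have h3 : tmul (star e * e) (1 : D) = 0 := by
    rw [← MinTensor.inclLeft_apply, map_mul, he, mul_zero]
  rw [h3, map_zero, zero_apply, inner_zero_right, State.toLin_one, mul_one, h1] at h2
  exact hTζ (inner_self_eq_zero.1 h2.symm)

/-- Any two unital *-homomorphisms `D → A ⊗ D` are homotopic if `D` is separable, strongly
self-absorbing and `K₁`-injective. -/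
theorem homotopic_of_isStronglySelfAbsorbing [TopologicalSpace.SeparableSpace D]
    (hD : IsStronglySelfAbsorbing D) (hK : IsKOneInjective D) (σ τ : D →⋆ₐ[ℂ] MinTensor A D) :
    Homotopic σ τ := by
  obtain ⟨φ, hφ⟩ := hD.exists_iso
  obtain ⟨μ, hμ⟩ := exists_asympCentral hφ
  let T : Set D := Set.range (TopologicalSpace.denseSeq D)
  have hT : Dense T := TopologicalSpace.denseRange_denseSeq D
  have hTc : T.Countable := Set.countable_range _
  -- The algebra A may be nonseparable, so E is generated by countably many elements; including 1 ⊗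
  -- D makes room for the central sequence 1 ⊗ μ n.
  let S : Set (MinTensor A D) := σ '' T ∪ τ '' T ∪ inclRight A D '' T
  have hS : S.Countable := ((hTc.image _).union (hTc.image _)).union (hTc.image _)
  have hsep : TopologicalSpace.SeparableSpace (closedAdjoin S) :=
    (isSeparable_closedAdjoin hS).separableSpace
  have hmem (f : D →⋆ₐ[ℂ] MinTensor A D) (hf : f '' T ⊆ S) (d : D) : f d ∈ closedAdjoin S := by
    have hcl : IsClosed (closedAdjoin S : Set (MinTensor A D)) := inferInstance
    have h1 : f d ∈ closure (f '' T) :=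
      image_closure_subset_closure_image (continuous_starHom f) ⟨d, hT d, rfl⟩
    exact closure_minimal (hf.trans (subset_closedAdjoin S)) hcl h1
  have hσ := hmem σ (Set.subset_union_left.trans Set.subset_union_left)
  have hτ := hmem τ (Set.subset_union_right.trans Set.subset_union_left)
  have hr := hmem (inclRight A D) Set.subset_union_right
  let ψ (n : ℕ) : D →⋆ₐ[ℂ] closedAdjoin S :=
    ((inclRight A D).codRestrict (closedAdjoin S) hr).comp (μ n)
  have hψ : AsympCentral ψ := fun e ↦ (hμ.inclRight_comp A) e.1
  obtain ⟨χ, hχ⟩ := exists_iso_homotopic_inclLeft hK hφ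
    (inclLeft_injective_of_embedding (closedAdjoin S).subtype Subtype.val_injective) hψ
  have hlr := homotopic_inclLeft_inclRight hK hφ
  have h := (homotopic_symm_comp_inclRight hlr hχ (σ.codRestrict _ hσ)).trans
    (homotopic_symm_comp_inclRight hlr hχ (τ.codRestrict _ hτ)).symm
  exact h.comp_left (closedAdjoin S).subtype

end SubalgebraOfTensor

end CStarTensor

end

theorem corollary2p3 {A D : Type*} [CStarAlgebra A] [CStarAlgebra D]
    [TopologicalSpace.SeparableSpace D]
    (hD : CStarTensor.IsStronglySelfAbsorbing D) (hK : CStarTensor.IsKOneInjective D) :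
    Nonempty (Unique (CStarTensor.HomotopyClasses D (CStarTensor.MinTensor A D))) := by
  refine ⟨⟨⟨Quotient.mk _ (CStarTensor.MinTensor.inclRight A D)⟩, fun x ↦ ?_⟩⟩
  induction x using Quotient.inductionOn with
  | h σ => exact Quotient.sound (CStarTensor.homotopic_of_isStronglySelfAbsorbing hD hK _ _)
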